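/- Theorem. Let $\alpha>0$, $\beta>0$, and for $t\ge 0$ let $w(x;t)=e^{-t/x}x^{\alpha}(1-x)^{\beta}$, $x\in[0,1]$. Let $P_n(x)=P_n(x;t)$, $n=0,1,2,\dots$, be the monic polynomials with $\deg P_n=n$ orthogonal with respect to $w(\cdot;t)$ on $[0,1]$, that is $\int_0^1P_m(x)P_n(x)w(x;t)\,dx=h_n(t)\,\delta_{m,n}$, and put $$R_n(t)=\frac{\beta}{h_n(t)}\int_0^1 P_n(y)^2\,w(y;t)\,\frac{dy}{1-y},\qquad S_n(t)=\frac{R_n(t)}{2n+1+\alpha+\beta}.$$ Then, for every $n\ge 0$, $S_n$ is twice differentiable on $(0,\infty)$, does not take the values $0$ and $1$ there, and satisfies for all $t>0$ $$S_n''=\frac{3S_n-1}{2S_n(S_n-1)}(S_n')^2-\frac{S_n'}{t}+\frac{(S_n-1)^2}{t^2}\left[\frac{(2n+1+\alpha+\beta)^2}{2}S_n-\frac{\beta^2}{2S_n}\right]+\frac{\alpha S_n}{t}-\frac{S_n(S_n+1)}{2(S_n-1)},$$ which is the fifth Painlevé equation $P_V\left(\frac{(2n+1+\alpha+\beta)^2}{2},-\frac{\beta^2}{2},\alpha,-\frac12\right)$,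 where $P_V(a,b,c,d)$ denotes $$y''=\frac{3y-1}{2y(y-1)}(y')^2-\frac{y'}{t}+\frac{(y-1)^2}{t^2}\left(ay+\frac{b}{y}\right)+\frac{cy}{t}+\frac{d\,y(y+1)}{y-1}.$$ -/

import Mathlib

open Polynomial

noncomputable section

namespace PollaczekJacobi

/-- The Pollaczek–Jacobi type weight `w(x;t) = e^{-t/x} x^α (1-x)^β` on `[0,1]`. -/
def weight (α β t x : ℝ) : ℝ :=
  Real.exp (-t / x) * x ^ α * (1 - x) ^ β

/-- The pairing `∫₀¹ p(x) q(x) w(x;t) dx` of two polynomials. -/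
def pairing (α β t : ℝ) (p q : ℝ[X]) : ℝ :=
  ∫ x in (0 : ℝ)..1, p.eval x * q.eval x * weight α β t x

/-- The monic orthogonal polynomials `P_n(x) = P_n(x;t)` of the weight, built from the monomials
by the Gram–Schmidt process. See `orthoPoly_monic`, `orthoPoly_natDegree`, `sqNorm_pos` and
`pairing_orthoPoly_of_ne` below. -/
def orthoPoly (α β t : ℝ) (n : ℕ) : ℝ[X] :=
  X ^ n - ∑ k : Fin n,
    C (pairing α β t (X ^ n) (orthoPoly α β t k) /
        pairing α β t (orthoPoly α β t k) (orthoPoly α β t k)) * orthoPoly α β t k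
termination_by n
decreasing_by all_goals exact k.2

/-- `h_n(t) = ∫₀¹ P_n(x)² w(x;t) dx`. -/
def sqNorm (α β : ℝ) (n : ℕ) (t : ℝ) : ℝ :=
  pairing α β t (orthoPoly α β t n) (orthoPoly α β t n)

/-- `R_n(t) = (β / h_n(t)) ∫₀¹ P_n(y)² w(y;t) dy / (1 - y)`. -/
def auxR (α β : ℝ) (n : ℕ) (t : ℝ) : ℝ :=
  β / sqNorm α β n t *
    ∫ y in (0 : ℝ)..1, (orthoPoly α β t n).eval y ^ 2 * weight α β t y / (1 - y)

/-- `S_n(t) = R_n(t) / (2n + 1 + α + β)`. -/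
def auxS (α β : ℝ) (n : ℕ) (t : ℝ) : ℝ :=
  auxR α β n t / (2 * (n : ℝ) + 1 + α + β)

/-- `y` is on `(0, ∞)` a (twice differentiable) solution of the fifth Painlevé equation
`P_V(a, b, c, d)`. The values `0` and `1`, where the equation is singular, are not attained. -/
def SolvesPainleveV (a b c d : ℝ) (y : ℝ → ℝ) : Prop :=
  ∀ t : ℝ, 0 < t →
    y t ≠ 0 ∧ y t ≠ 1 ∧ DifferentiableAt ℝ y t ∧ DifferentiableAt ℝ (deriv y) t ∧
    deriv (deriv y) t =
      (3 * y t - 1) / (2 * y t * (y t - 1)) * deriv y t ^ 2 - deriv y t / t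
        + (y t - 1) ^ 2 / t ^ 2 * (a * y t + b / y t)
        + c * y t / t + d * (y t * (y t + 1)) / (y t - 1)

/-! Verification that `orthoPoly` is the sequence of monic orthogonal polynomials. -/

theorem intervalIntegrable_eval_mul_weight {α β t : ℝ} (hα : 0 < α) (hβ : 0 < β) (ht : 0 ≤ t)
    (p : ℝ[X]) :
    IntervalIntegrable (fun x => p.eval x * weight α β t x) MeasureTheory.volume 0 1 := by
  have hw : IntervalIntegrable (weight α β t) MeasureTheory.volume 0 1 := by
    rw [intervalIntegrable_iff_integrableOn_Ioc_of_le zero_le_one]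
    refine MeasureTheory.Measure.integrableOn_of_bounded (M := 1) (by simp) ?_ ?_
    · refine Measurable.aestronglyMeasurable ?_
      unfold weight
      fun_prop
    · refine (MeasureTheory.ae_restrict_iff' measurableSet_Ioc).2 (Filter.Eventually.of_forall ?_)
      rintro x ⟨hx0, hx1⟩
      have h1 : Real.exp (-t / x) ≤ 1 := by
        rw [Real.exp_le_one_iff]
        exact div_nonpos_of_nonpos_of_nonneg (by linarith) hx0.le
      have h2 : x ^ α ≤ 1 := Real.rpow_le_one hx0.le hx1 hα.le
      have h3 : (1 - x) ^ β ≤ 1 := Real.rpow_le_one (by linarith) (by linarith) hβ.le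
      have h4 : 0 ≤ x ^ α := Real.rpow_nonneg hx0.le _
      have h5 : 0 ≤ (1 - x) ^ β := Real.rpow_nonneg (by linarith) _
      have h6 := Real.exp_pos (-t / x)
      have h7 : Real.exp (-t / x) * x ^ α ≤ 1 := mul_le_one₀ h1 h4 h2
      have h8 : weight α β t x ≤ 1 := mul_le_one₀ h7 h5 h3
      have h9 : 0 ≤ weight α β t x := mul_nonneg (mul_nonneg h6.le h4) h5
      rw [Real.norm_eq_abs, abs_of_nonneg h9]
      exact h8
  exact hw.continuousOn_mul p.continuous.continuousOn

theorem pairing_comm (α β t : ℝ) (p q : ℝ[X]) : pairing α β t p q = pairing α β t q p := by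
  unfold pairing
  simp only [mul_comm (p.eval _)]

theorem pairing_sub_left {α β t : ℝ} (hα : 0 < α) (hβ : 0 < β) (ht : 0 ≤ t) (p q r : ℝ[X]) :
    pairing α β t (p - q) r = pairing α β t p r - pairing α β t q r := by
  unfold pairing
  rw [← intervalIntegral.integral_sub]
  · congr 1; ext x; simp; ring
  · simpa using intervalIntegrable_eval_mul_weight hα hβ ht (p * r)
  · simpa using intervalIntegrable_eval_mul_weight hα hβ ht (q * r)

theorem pairing_sum_left {α β t : ℝ} (hα : 0 < α) (hβ : 0 < β) (ht : 0 ≤ t) {ι : Type*}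
    (s : Finset ι) (c : ι → ℝ) (p : ι → ℝ[X]) (r : ℝ[X]) :
    pairing α β t (∑ i ∈ s, C (c i) * p i) r = ∑ i ∈ s, c i * pairing α β t (p i) r := by
  unfold pairing
  simp only [← intervalIntegral.integral_const_mul]
  rw [← intervalIntegral.integral_finsetSum]
  · congr 1; ext x
    simp only [eval_finsetSum, eval_mul, eval_C, Finset.sum_mul]
    exact Finset.sum_congr rfl fun i _ => by ring
  · intro i _
    simpa using (intervalIntegrable_eval_mul_weight hα hβ ht (p i * r)).const_mul (c i)

theorem pairing_self_pos {α β t : ℝ} (hα : 0 < α) (hβ : 0 < β) (ht : 0 ≤ t) {p : ℝ[X]}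
    (hp : p ≠ 0) : 0 < pairing α β t p p := by
  have hi : IntervalIntegrable (fun x => p.eval x * p.eval x * weight α β t x)
      MeasureTheory.volume 0 1 := by
    simpa using intervalIntegrable_eval_mul_weight hα hβ ht (p * p)
  have hnn : ∀ x ∈ Set.Ioc (0 : ℝ) 1, 0 ≤ p.eval x * p.eval x * weight α β t x := fun x hx =>
    mul_nonneg (mul_self_nonneg _) (mul_nonneg (mul_nonneg (Real.exp_pos _).le
      (Real.rpow_nonneg hx.1.le _)) (Real.rpow_nonneg (by linarith [hx.2]) _))
  unfold pairing
  rw [intervalIntegral.integral_of_le zero_le_one,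
    MeasureTheory.setIntegral_pos_iff_support_of_nonneg_ae
      ((MeasureTheory.ae_restrict_iff' measurableSet_Ioc).2 (Filter.Eventually.of_forall hnn))
      ((intervalIntegrable_iff_integrableOn_Ioc_of_le zero_le_one).1 hi)]
  have hsub : Set.Ioo (0 : ℝ) 1 \ {x | p.IsRoot x} ⊆
      Function.support (fun x => p.eval x * p.eval x * weight α β t x) ∩ Set.Ioc 0 1 := by
    rintro x ⟨⟨hx0, hx1⟩, hx⟩
    have hx' : p.eval x ≠ 0 := hx
    refine ⟨?_, hx0, hx1.le⟩
    exact mul_ne_zero (mul_ne_zero hx' hx') (mul_pos (mul_pos (Real.exp_pos _)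
      (Real.rpow_pos_of_pos hx0 _)) (Real.rpow_pos_of_pos (by linarith) _)).ne'
  refine lt_of_lt_of_le ?_ (MeasureTheory.measure_mono hsub)
  rw [MeasureTheory.measure_sdiff_null ((finite_setOfPred_isRoot hp).measure_zero _)]
  simp

theorem orthoPoly_monic_natDegree (α β t : ℝ) (n : ℕ) :
    (orthoPoly α β t n).Monic ∧ (orthoPoly α β t n).natDegree = n := by
  induction n using Nat.strong_induction_on with
  | _ n ih =>
    rw [orthoPoly]
    have hdeg : (∑ k : Fin n,
        C (pairing α β t (X ^ n) (orthoPoly α β t k) /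
          pairing α β t (orthoPoly α β t k) (orthoPoly α β t k)) *
            orthoPoly α β t k).degree < (n : WithBot ℕ) := by
      refine lt_of_le_of_lt (degree_sum_le _ _) ?_
      refine (Finset.sup_lt_iff (WithBot.bot_lt_coe n)).2 fun k _ => ?_
      rw [← smul_eq_C_mul]
      refine lt_of_le_of_lt (degree_smul_le _ _) ?_
      rw [degree_eq_natDegree (ih k k.2).1.ne_zero, (ih k k.2).2]
      exact Nat.cast_lt.2 k.2
    refine ⟨monic_X_pow_sub hdeg, natDegree_eq_of_degree_eq_some ?_⟩
    rw [degree_sub_eq_left_of_degree_lt (by rwa [degree_X_pow]), degree_X_pow]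

theorem orthoPoly_monic (α β t : ℝ) (n : ℕ) : (orthoPoly α β t n).Monic :=
  (orthoPoly_monic_natDegree α β t n).1

theorem orthoPoly_natDegree (α β t : ℝ) (n : ℕ) : (orthoPoly α β t n).natDegree = n :=
  (orthoPoly_monic_natDegree α β t n).2

theorem sqNorm_pos {α β t : ℝ} (hα : 0 < α) (hβ : 0 < β) (ht : 0 ≤ t) (n : ℕ) :
    0 < sqNorm α β n t :=
  pairing_self_pos hα hβ ht (orthoPoly_monic α β t n).ne_zero

theorem pairing_orthoPoly_of_lt {α β t : ℝ} (hα : 0 < α) (hβ : 0 < β) (ht : 0 ≤ t) (n : ℕ) :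
    ∀ m < n, pairing α β t (orthoPoly α β t n) (orthoPoly α β t m) = 0 := by
  induction n using Nat.strong_induction_on with
  | _ n ih =>
    intro m hm
    rw [orthoPoly, pairing_sub_left hα hβ ht, pairing_sum_left hα hβ ht,
      Finset.sum_eq_single (⟨m, hm⟩ : Fin n)]
    · have h : pairing α β t (orthoPoly α β t m) (orthoPoly α β t m) ≠ 0 :=
        (sqNorm_pos hα hβ ht m).ne'
      simp only
      rw [div_mul_cancel₀ _ h, sub_self]
    · intro k _ hk
      have hk' : (k : ℕ) ≠ m := fun h => hk (Fin.ext h)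
      rcases lt_or_gt_of_ne hk' with h | h
      · rw [pairing_comm α β t (orthoPoly α β t (k : ℕ)) (orthoPoly α β t m), ih m hm k h,
          mul_zero]
      · rw [ih k k.2 m h, mul_zero]
    · simp

theorem pairing_orthoPoly_of_ne {α β t : ℝ} (hα : 0 < α) (hβ : 0 < β) (ht : 0 ≤ t) {m n : ℕ}
    (hmn : m ≠ n) : pairing α β t (orthoPoly α β t m) (orthoPoly α β t n) = 0 := by
  rcases lt_or_gt_of_ne hmn with h | h
  · rw [pairing_comm, pairing_orthoPoly_of_lt hα hβ ht n m h]
  · exact pairing_orthoPoly_of_lt hα hβ ht m n h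

end PollaczekJacobi

end

/-! For t > 0 the factor e^{-t/x} beats every power of x at 0. Integrals of polynomials against x^a
(1-x)^b e^{-t/x} therefore exist for all real a and b > -1. The t-derivative of the weight lowers a
by one, and for b > 0 integrating (p w)' leaves no boundary terms (`moment_integration_by_parts`).
Taking p = P_n², x P_n², P_{n+1} P_n and x P_{n+1} P_n gives four sum rules.

For index n + 1, let N = 2(n+1) + 1 + α + β, R = R_{n+1}, r = `auxr`, and let ρ be the subleading
coefficient of P_{n+1}. Eliminating the values of the polynomials at 0 and 1 and the remaining
integrals (`algebraic_relations`, `auxR_relations`) expresses h_{n+1}/h_n through r and ρ, and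
leaves one polynomial constraint on R, r, ρ. Differentiating the orthogonality relations in t gives
a first-order system for the same three functions (`hasDerivAt_auxR_succ`, `hasDerivAt_coeff`,
`hasDerivAt_auxr`). Modulo the constraint, r and ρ drop out of R'', and what is left is P_V for R/N
(`painleveV_of_system`).

A sum rule also gives R > N (`lt_auxR`), so S_n > 1 avoids both singular values. Index 0 fits the
same system with r = ρ = 0. -/

noncomputable section

namespace PollaczekJacobi

open MeasureTheory Set Filter Topology

/-! ### Moments with shifted exponents: existence, t-derivative, integration by parts. -/

/-- `∫₀¹ p(x) w(x) dx` for the weight `w(x) = e^{-t/x} x^a (1-x)^b` with arbitrary exponents. -/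
def moment (a b t : ℝ) (p : ℝ[X]) : ℝ :=
  ∫ x in (0 : ℝ)..1, p.eval x * weight a b t x

theorem weight_mul_self {a b t x : ℝ} (hx : 0 < x) :
    x * weight (a - 1) b t x = weight a b t x := by
  unfold weight
  rw [Real.rpow_sub_one hx.ne']
  field_simp

theorem one_sub_mul_weight {a b t x : ℝ} (hx : x < 1) :
    (1 - x) * weight a (b - 1) t x = weight a b t x := by
  unfold weight
  have h : 1 - x ≠ 0 := by linarith
  rw [Real.rpow_sub_one h]
  field_simp

/-- Exponential decay absorbs any negative power, because e^{t/x} ≥ (t/x)^k / k!. Hence no lower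
bound on the exponent at 0 is needed when t > 0. -/
theorem exists_exp_mul_rpow_le (a : ℝ) {t : ℝ} (ht : 0 < t) :
    ∃ C, ∀ x ∈ Ioc (0 : ℝ) 1, Real.exp (-t / x) * x ^ a ≤ C := by
  obtain ⟨k, hk⟩ := exists_nat_ge (-a)
  refine ⟨k.factorial / t ^ k, fun x hx => ?_⟩
  have h1 : x ^ a ≤ x ^ (-(k : ℝ)) :=
    Real.rpow_le_rpow_of_exponent_ge hx.1 hx.2 (by linarith)
  have h2 := Real.pow_div_factorial_le_exp (t / x) (div_pos ht hx.1).le k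
  have h3 : x ^ (-(k : ℝ)) = (x ^ k)⁻¹ := by rw [Real.rpow_neg hx.1.le, Real.rpow_natCast]
  have hxk : 0 < x ^ k := pow_pos hx.1 k
  have hf : (0 : ℝ) < k.factorial := by exact_mod_cast k.factorial_pos
  have h4 : Real.exp (-t / x) * Real.exp (t / x) = 1 := by
    rw [← Real.exp_add]; simp [neg_div]
  have h5 : 0 < Real.exp (-t / x) := Real.exp_pos _
  calc Real.exp (-t / x) * x ^ a ≤ Real.exp (-t / x) * (x ^ k)⁻¹ := by
        rw [← h3]; gcongr
    _ = Real.exp (-t / x) * ((t / x) ^ k / k.factorial) * (k.factorial / t ^ k) := by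
        rw [div_pow]
        field_simp
    _ ≤ Real.exp (-t / x) * Real.exp (t / x) * (k.factorial / t ^ k) := by gcongr
    _ = k.factorial / t ^ k := by rw [h4, one_mul]

theorem measurable_weight (a b t : ℝ) : Measurable (weight a b t) := by
  unfold weight
  fun_prop

theorem intervalIntegrable_weight (a : ℝ) {b t : ℝ} (hb : -1 < b) (ht : 0 < t) :
    IntervalIntegrable (weight a b t) volume 0 1 := by
  obtain ⟨C, hC⟩ := exists_exp_mul_rpow_le a ht
  have h1 : IntervalIntegrable (fun x : ℝ => (1 - x) ^ b) volume 0 1 := by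
    have := (intervalIntegral.intervalIntegrable_rpow' hb (a := 0) (b := 1)).comp_sub_left 1
    simpa using this.symm
  refine (h1.const_mul C).mono_fun (measurable_weight a b t).aestronglyMeasurable ?_
  rw [uIoc_of_le zero_le_one]
  refine (ae_restrict_iff' measurableSet_Ioc).2 (Eventually.of_forall fun x hx => ?_)
  have h2 : 0 ≤ Real.exp (-t / x) * x ^ a :=
    mul_nonneg (Real.exp_pos _).le (Real.rpow_nonneg hx.1.le _)
  unfold weight
  simp only
  rw [norm_mul, norm_mul C, Real.norm_of_nonneg h2]
  gcongr
  exact (hC x hx).trans (le_abs_self C)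

theorem intervalIntegrable_moment (a : ℝ) {b t : ℝ} (hb : -1 < b) (ht : 0 < t) (p : ℝ[X]) :
    IntervalIntegrable (fun x => p.eval x * weight a b t x) volume 0 1 :=
  (intervalIntegrable_weight a hb ht).continuousOn_mul p.continuous.continuousOn

theorem moment_add (a : ℝ) {b t : ℝ} (hb : -1 < b) (ht : 0 < t) (p q : ℝ[X]) :
    moment a b t (p + q) = moment a b t p + moment a b t q := by
  unfold moment
  rw [← intervalIntegral.integral_add (intervalIntegrable_moment a hb ht p)
    (intervalIntegrable_moment a hb ht q)]
  simp only [eval_add, add_mul]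

theorem moment_C_mul (a b t c : ℝ) (p : ℝ[X]) :
    moment a b t (C c * p) = c * moment a b t p := by
  unfold moment
  rw [← intervalIntegral.integral_const_mul]
  simp only [eval_mul, eval_C, mul_assoc]

theorem moment_sub (a : ℝ) {b t : ℝ} (hb : -1 < b) (ht : 0 < t) (p q : ℝ[X]) :
    moment a b t (p - q) = moment a b t p - moment a b t q := by
  have h : p - q = p + C (-1) * q := by simp [sub_eq_add_neg]
  rw [h, moment_add a hb ht, moment_C_mul]
  ring

theorem moment_zero (a b t : ℝ) : moment a b t 0 = 0 := by simp [moment]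

theorem moment_sum (a : ℝ) {b t : ℝ} (hb : -1 < b) (ht : 0 < t) {ι : Type*} (s : Finset ι)
    (p : ι → ℝ[X]) : moment a b t (∑ i ∈ s, p i) = ∑ i ∈ s, moment a b t (p i) := by
  classical
  induction s using Finset.induction_on with
  | empty => simp [moment_zero]
  | insert i s hi ih => rw [Finset.sum_insert hi, Finset.sum_insert hi, moment_add a hb ht, ih]

/-- The endpoints are null, so identities that divide by x or 1 - x need checking only in the open
interval. -/
theorem integral_congr_Ioo {f g : ℝ → ℝ} (h : ∀ x ∈ Ioo (0 : ℝ) 1, f x = g x) :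
    ∫ x in (0 : ℝ)..1, f x = ∫ x in (0 : ℝ)..1, g x := by
  rw [intervalIntegral.integral_of_le zero_le_one, intervalIntegral.integral_of_le zero_le_one,
    integral_Ioc_eq_integral_Ioo, integral_Ioc_eq_integral_Ioo]
  exact setIntegral_congr_fun measurableSet_Ioo h

theorem moment_X_mul (a b t : ℝ) (p : ℝ[X]) :
    moment (a - 1) b t (X * p) = moment a b t p := by
  refine integral_congr_Ioo fun x hx => ?_
  rw [← weight_mul_self (a := a) hx.1, eval_mul, eval_X]
  ring

theorem moment_one_sub_X_mul (a b t : ℝ) (p : ℝ[X]) :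
    moment a (b - 1) t ((1 - X) * p) = moment a b t p := by
  refine integral_congr_Ioo fun x hx => ?_
  rw [← one_sub_mul_weight (b := b) hx.2]
  simp only [eval_mul, eval_sub, eval_one, eval_X]
  ring

/-- This is 1/(x(1-x)) = 1/x + 1/(1-x); it splits the t-derivative of the integral defining R_n. -/
theorem moment_partial_fraction (a : ℝ) {b t : ℝ} (hb : 0 < b) (ht : 0 < t) (p : ℝ[X]) :
    moment (a - 1) (b - 1) t p = moment (a - 1) b t p + moment a (b - 1) t p := by
  rw [← moment_X_mul a (b - 1), ← moment_one_sub_X_mul (a - 1) b,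
    ← moment_add _ (by linarith) ht]
  congr 1
  ring

theorem pairing_eq_moment (α β t : ℝ) (p q : ℝ[X]) :
    pairing α β t p q = moment α β t (p * q) := by
  simp only [pairing, moment, eval_mul]

theorem sqNorm_eq_moment (α β : ℝ) (n : ℕ) (t : ℝ) :
    sqNorm α β n t = moment α β t (orthoPoly α β t n * orthoPoly α β t n) :=
  pairing_eq_moment _ _ _ _ _

theorem auxR_eq_moment (α β : ℝ) (n : ℕ) (t : ℝ) :
    auxR α β n t = β / sqNorm α β n t *
      moment α (β - 1) t (orthoPoly α β t n * orthoPoly α β t n) := by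
  unfold auxR
  congr 1
  refine integral_congr_Ioo fun x hx => ?_
  have h : 1 - x ≠ 0 := by linarith [hx.2]
  rw [← one_sub_mul_weight hx.2, eval_mul]
  field_simp

theorem hasDerivAt_moment (a : ℝ) {b t : ℝ} (hb : -1 < b) (ht : 0 < t) (p : ℝ[X]) :
    HasDerivAt (fun s => moment a b s p) (-moment (a - 1) b t p) t := by
  have key := (intervalIntegral.hasDerivAt_integral_of_dominated_loc_of_deriv_le
    -- Since e^{-s/x} decreases in s, the integrand at t/2 dominates for all s > t/2.
    (μ := volume) (a := 0) (b := 1) (x₀ := t) (s := Ioi (t / 2))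
    (F := fun s x => p.eval x * weight a b s x)
    (F' := fun s x => -(p.eval x * weight (a - 1) b s x))
    (bound := fun x => ‖p.eval x * weight (a - 1) b (t / 2) x‖)
    (Ioi_mem_nhds (by linarith)) ?_ (intervalIntegrable_moment a hb ht p) ?_ ?_ ?_ ?_).2
  · rw [intervalIntegral.integral_neg] at key
    exact key
  · exact Eventually.of_forall fun s =>
      (p.continuous.measurable.mul (measurable_weight a b s)).aestronglyMeasurable
  · exact (p.continuous.measurable.mul (measurable_weight (a - 1) b t)).neg.aestronglyMeasurable
  · refine Eventually.of_forall fun x hx s hs => ?_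
    rw [uIoc_of_le zero_le_one] at hx
    have hs' : t / 2 < s := hs
    rw [norm_neg, norm_mul, norm_mul]
    unfold weight
    simp only [norm_mul, Real.norm_of_nonneg (Real.exp_pos _).le]
    have hx0 := hx.1
    gcongr
  · exact (intervalIntegrable_moment (a - 1) hb (by linarith) p).norm
  · refine Eventually.of_forall fun x hx s hs => ?_
    rw [uIoc_of_le zero_le_one] at hx
    have h1 : HasDerivAt (fun s : ℝ => -s / x) (-1 / x) s :=
      ((hasDerivAt_id s).neg).div_const x
    have h2 := (((h1.exp.mul_const (x ^ a)).mul_const ((1 - x) ^ b)).const_mul (p.eval x))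
    refine h2.congr_deriv ?_
    have hx0 : x ≠ 0 := hx.1.ne'
    unfold weight
    rw [Real.rpow_sub_one hx0]
    field_simp

/-- The integral of (p w)' vanishes, where w'/w = t/x² + a/x - b/(1-x). The boundary terms die
because t > 0 at x = 0 and b > 0 at x = 1. -/
theorem moment_integration_by_parts (a : ℝ) {b t : ℝ} (hb : 0 < b) (ht : 0 < t) (p : ℝ[X]) :
    moment a b t (derivative p) + t * moment (a - 1 - 1) b t p + a * moment (a - 1) b t p
      - b * moment a (b - 1) t p = 0 := by
  have hb' : -1 < b := by linarith
  have i1 := intervalIntegrable_moment a hb' ht (derivative p)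
  have i2 := (intervalIntegrable_moment (a - 1 - 1) hb' ht p).const_mul t
  have i3 := (intervalIntegrable_moment (a - 1) hb' ht p).const_mul a
  have i4 := (intervalIntegrable_moment a (by linarith : -1 < b - 1) ht p).const_mul b
  have key := intervalIntegral.integral_eq_sub_of_hasDerivAt_of_tendsto (zero_lt_one' ℝ)
    (f := fun x => p.eval x * weight a b t x) (fa := 0) (fb := 0) ?_
    (((i1.add i2).add i3).sub i4) ?_ ?_
  · rw [intervalIntegral.integral_sub ((i1.add i2).add i3) i4,
      intervalIntegral.integral_add (i1.add i2) i3, intervalIntegral.integral_add i1 i2] at key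
    simp only [intervalIntegral.integral_const_mul] at key
    simpa [moment] using key
  · intro x hx
    have hx0 : x ≠ 0 := hx.1.ne'
    have hx1 : 1 - x ≠ 0 := by linarith [hx.2]
    have h1 : HasDerivAt (fun x : ℝ => -t / x) (t / x ^ 2) x := by
      have := (hasDerivAt_inv hx0).const_mul (-t)
      refine (this.congr_deriv ?_)
      field_simp
    have h2 : HasDerivAt (fun x : ℝ => x ^ a) (a * x ^ (a - 1)) x :=
      Real.hasDerivAt_rpow_const (Or.inl hx0)
    have h3 : HasDerivAt (fun x : ℝ => (1 - x) ^ b) (-1 * b * (1 - x) ^ (b - 1)) x :=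
      ((hasDerivAt_id x).const_sub 1).rpow_const (Or.inl hx1)
    refine ((p.hasDerivAt x).mul ((h1.exp.mul h2).mul h3)).congr_deriv ?_
    simp only [weight, Pi.mul_apply]
    rw [Real.rpow_sub_one hx0 (a - 1), Real.rpow_sub_one hx0 a, Real.rpow_sub_one hx1]
    field_simp
    ring
  -- One factor x is split off from x^a: it tends to 0, while e^{-t/x} x^{a-1} stays bounded.
  · have h1 : Tendsto (fun x : ℝ => x * (p.eval x * (1 - x) ^ b)) (𝓝[>] 0) (𝓝 0) := by
      have : ContinuousAt (fun x : ℝ => x * (p.eval x * (1 - x) ^ b)) 0 := by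
        refine continuousAt_id.mul (p.continuous.continuousAt.mul ?_)
        exact ContinuousAt.rpow_const (by fun_prop) (Or.inl (by norm_num))
      have h := this.tendsto
      simp only [zero_mul] at h
      exact h.mono_left nhdsWithin_le_nhds
    obtain ⟨K, hK⟩ := exists_exp_mul_rpow_le (a - 1) ht
    have h2 := (h1.norm).const_mul K
    simp only [norm_zero, mul_zero] at h2
    refine squeeze_zero_norm' ?_ h2
    filter_upwards [Ioc_mem_nhdsGT (zero_lt_one' ℝ)] with x hx
    have e : p.eval x * weight a b t x =
        (Real.exp (-t / x) * x ^ (a - 1)) * (x * (p.eval x * (1 - x) ^ b)) := by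
      rw [← weight_mul_self hx.1]
      unfold weight
      ring
    rw [e, norm_mul, Real.norm_of_nonneg
      (mul_nonneg (Real.exp_pos _).le (Real.rpow_nonneg hx.1.le _))]
    gcongr
    exact hK x hx
  · have : ContinuousAt (fun x => p.eval x * weight a b t x) 1 := by
      unfold weight
      refine p.continuous.continuousAt.mul ((ContinuousAt.mul ?_ ?_).mul ?_)
      · exact Real.continuous_exp.continuousAt.comp
          (continuousAt_const.div continuousAt_id one_ne_zero)
      · exact continuousAt_id.rpow_const (Or.inl one_ne_zero)
      · exact ContinuousAt.rpow_const (by fun_prop) (Or.inr hb.le)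
    have h := this.tendsto
    simp only [weight, sub_self, Real.zero_rpow hb.ne', mul_zero] at h
    exact h.mono_left nhdsWithin_le_nhds

/-! ### Orthogonality, and integrals of P_n p against w, w/x, w/x², w/(1-x). -/

theorem degree_lt_of_coeff {p : ℝ[X]} {n : ℕ} (h : ∀ k, n ≤ k → p.coeff k = 0) :
    p.degree < n :=
  (degree_lt_iff_coeff_zero p n).2 h

theorem coeff_orthoPoly_self (α β t : ℝ) (n : ℕ) : (orthoPoly α β t n).coeff n = 1 := by
  have h := orthoPoly_monic α β t n
  rwa [Monic, leadingCoeff, orthoPoly_natDegree] at h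

theorem coeff_orthoPoly_of_lt (α β t : ℝ) {n k : ℕ} (h : n < k) :
    (orthoPoly α β t n).coeff k = 0 :=
  coeff_eq_zero_of_natDegree_lt (by rwa [orthoPoly_natDegree])

theorem degree_orthoPoly_lt (α β t : ℝ) {n m : ℕ} (h : n < m) :
    (orthoPoly α β t n).degree < m :=
  degree_lt_of_coeff fun _ hk => coeff_orthoPoly_of_lt α β t (h.trans_le hk)

/-- Subtracting the leading term along `P_n` lowers the degree. -/
theorem degree_sub_orthoPoly_lt (α β t : ℝ) {p : ℝ[X]} {n : ℕ}
    (hp : p.degree < ((n + 1 : ℕ) : WithBot ℕ)) :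
    (p - C (p.coeff n) * orthoPoly α β t n).degree < n := by
  refine degree_lt_of_coeff fun k hk => ?_
  rw [coeff_sub, coeff_C_mul]
  rcases hk.eq_or_lt with rfl | hk
  · rw [coeff_orthoPoly_self]; ring
  · rw [coeff_orthoPoly_of_lt α β t hk, (degree_lt_iff_coeff_zero p (n + 1)).1 hp k hk]; ring

theorem degree_divX_lt_of_degree_lt {p : ℝ[X]} {n : ℕ}
    (hp : p.degree < ((n + 1 : ℕ) : WithBot ℕ)) : p.divX.degree < n := by
  refine degree_lt_of_coeff fun k hk => ?_
  rw [coeff_divX]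
  exact (degree_lt_iff_coeff_zero p (n + 1)).1 hp _ (by omega)

theorem moment_pred_right_X_mul (α : ℝ) {β t : ℝ} (hβ : 0 < β) (ht : 0 < t) (p : ℝ[X]) :
    moment α (β - 1) t (X * p) = moment α (β - 1) t p - moment α β t p := by
  have e : X * p = p - (1 - X) * p := by ring
  rw [e, moment_sub _ (by linarith) ht, moment_one_sub_X_mul]

section Relations

variable {α β t : ℝ} (hα : 0 < α) (hβ : 0 < β) (ht : 0 < t)

include hα hβ ht

theorem moment_orthoPoly_mul_eq_zero (n : ℕ) {p : ℝ[X]} (hp : p.degree < n) :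
    moment α β t (orthoPoly α β t n * p) = 0 := by
  have hb : -1 < β := by linarith
  suffices h : ∀ m ≤ n, ∀ p : ℝ[X], p.degree < m →
      moment α β t (orthoPoly α β t n * p) = 0 from h n le_rfl p hp
  intro m
  induction m with
  | zero =>
    intro _ p hp
    have : p = 0 := by
      ext k
      exact (degree_lt_iff_coeff_zero p 0).1 hp k (Nat.zero_le k)
    rw [this, mul_zero, moment_zero]
  | succ m ih =>
    intro hm p hp
    have h1 := ih (by omega) _ (degree_sub_orthoPoly_lt α β t hp)
    have h2 := pairing_orthoPoly_of_lt hα hβ ht.le n m (by omega)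
    rw [pairing_eq_moment] at h2
    have e : orthoPoly α β t n * p = orthoPoly α β t n * (p - C (p.coeff m) * orthoPoly α β t m) +
        C (p.coeff m) * (orthoPoly α β t n * orthoPoly α β t m) := by ring
    rw [e, moment_add α hb ht, moment_C_mul, h1, h2]
    ring

theorem moment_orthoPoly_mul (n : ℕ) {p : ℝ[X]} (hp : p.degree < ((n + 1 : ℕ) : WithBot ℕ)) :
    moment α β t (orthoPoly α β t n * p) = p.coeff n * sqNorm α β n t := by
  have h1 := moment_orthoPoly_mul_eq_zero hα hβ ht n (degree_sub_orthoPoly_lt α β t hp)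
  have e : orthoPoly α β t n * p = orthoPoly α β t n * (p - C (p.coeff n) * orthoPoly α β t n) +
      C (p.coeff n) * (orthoPoly α β t n * orthoPoly α β t n) := by ring
  rw [e, moment_add α (by linarith) ht, moment_C_mul, h1, ← sqNorm_eq_moment]
  ring

/-- `∫ P_n p w dx / x`. -/
theorem moment_pred_orthoPoly_mul (n : ℕ) {p : ℝ[X]}
    (hp : p.degree < ((n + 1 + 1 : ℕ) : WithBot ℕ)) :
    moment (α - 1) β t (orthoPoly α β t n * p) =
      p.coeff 0 * moment (α - 1) β t (orthoPoly α β t n) + p.coeff (n + 1) * sqNorm α β n t := by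
  -- Writing p = p(0) + x g cancels the pole in the second term, and orthogonality leaves only the
  -- top coefficient of g.
  have e : orthoPoly α β t n * p =
      C (p.coeff 0) * orthoPoly α β t n + X * (orthoPoly α β t n * p.divX) := by
    conv_lhs => rw [← X_mul_divX_add p]
    ring
  rw [e, moment_add _ (by linarith) ht, moment_C_mul, moment_X_mul,
    moment_orthoPoly_mul hα hβ ht n (degree_divX_lt_of_degree_lt hp), coeff_divX]

/-- `∫ P_n p w dx / x²`. -/
theorem moment_pred_pred_orthoPoly_mul (n : ℕ) {p : ℝ[X]}
    (hp : p.degree < ((n + 1 + 1 : ℕ) : WithBot ℕ)) :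
    moment (α - 1 - 1) β t (orthoPoly α β t n * p) =
      p.coeff 0 * moment (α - 1 - 1) β t (orthoPoly α β t n) +
        p.coeff 1 * moment (α - 1) β t (orthoPoly α β t n) := by
  have e : orthoPoly α β t n * p =
      C (p.coeff 0) * orthoPoly α β t n + X * (orthoPoly α β t n * p.divX) := by
    conv_lhs => rw [← X_mul_divX_add p]
    ring
  have hd := degree_divX_lt_of_degree_lt hp
  rw [e, moment_add _ (by linarith) ht, moment_C_mul, moment_X_mul,
    moment_pred_orthoPoly_mul hα hβ ht n (hd.trans (by exact_mod_cast Nat.lt_succ_self _)),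
    (degree_lt_iff_coeff_zero p.divX (n + 1)).1 hd _ le_rfl, coeff_divX]
  simp

/-- `∫ P_n p w dx / (1 - x)`. -/
theorem moment_pred_right_orthoPoly_mul (n : ℕ) {p : ℝ[X]}
    (hp : p.degree < ((n + 1 + 1 : ℕ) : WithBot ℕ)) :
    moment α (β - 1) t (orthoPoly α β t n * p) =
      p.eval 1 * moment α (β - 1) t (orthoPoly α β t n) - p.coeff (n + 1) * sqNorm α β n t := by
  -- The same device at the other endpoint: p = p(1) + (x-1) g.
  set g := p /ₘ (X - C 1) with hg
  have hpg : p = C (p.eval 1) + (X - 1) * g := by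
    have := modByMonic_add_div p (X - C (1 : ℝ))
    rw [modByMonic_X_sub_C_eq_C_eval] at this
    rw [C_1] at this
    rw [hg, C_1]
    exact this.symm
  have hdeg : g.degree < ((n + 1 : ℕ) : WithBot ℕ) := by
    by_cases hg0 : g = 0
    · rw [hg0, degree_zero]; exact WithBot.bot_lt_coe _
    · have h1 : g.natDegree = p.natDegree - 1 := by
        rw [hg, natDegree_divByMonic _ (monic_X_sub_C 1), natDegree_X_sub_C]
      have h2 : p.natDegree ≤ n + 1 := by
        rw [natDegree_le_iff_coeff_eq_zero]
        exact fun k hk => (degree_lt_iff_coeff_zero p _).1 hp k hk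
      rw [degree_eq_natDegree hg0]
      exact_mod_cast (by omega : g.natDegree < n + 1)
  have hc : p.coeff (n + 1) = g.coeff n := by
    have h1 := congrArg (fun q => coeff q (n + 1)) hpg
    simp only [coeff_add, sub_mul, one_mul, coeff_sub, coeff_X_mul, coeff_C_succ] at h1
    rw [h1, (degree_lt_iff_coeff_zero g (n + 1)).1 hdeg _ le_rfl]
    ring
  have e : orthoPoly α β t n * p = C (p.eval 1) * orthoPoly α β t n -
      (1 - X) * (orthoPoly α β t n * g) := by
    conv_lhs => rw [hpg]
    ring
  rw [e, moment_sub _ (by linarith) ht, moment_C_mul, moment_one_sub_X_mul,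
    moment_orthoPoly_mul hα hβ ht n hdeg, hc]

/-! ### The four sum rules. -/

/-- `∫ v'(x) P_n² w dx = 0`, where `w = e^{-v}`. -/
theorem sum_rule_sq (n : ℕ) :
    t * moment (α - 1 - 1) β t (orthoPoly α β t n * orthoPoly α β t n) +
      α * moment (α - 1) β t (orthoPoly α β t n * orthoPoly α β t n) =
      β * moment α (β - 1) t (orthoPoly α β t n * orthoPoly α β t n) := by
  have h1 := moment_integration_by_parts α hβ ht (orthoPoly α β t n * orthoPoly α β t n)
  have h2 : moment α β t (orthoPoly α β t n * derivative (orthoPoly α β t n)) = 0 := by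
    refine moment_orthoPoly_mul_eq_zero hα hβ ht n (degree_lt_of_coeff fun k hk => ?_)
    rw [coeff_derivative, coeff_orthoPoly_of_lt α β t (by omega), zero_mul]
  have e : derivative (orthoPoly α β t n * orthoPoly α β t n) =
      C 2 * (orthoPoly α β t n * derivative (orthoPoly α β t n)) := by
    rw [derivative_mul, map_ofNat]; ring
  rw [e, moment_C_mul, h2] at h1
  linarith

/-- `∫ x v'(x) P_n² w dx = (2n+1) h_n`. -/
theorem sum_rule_X_mul_sq (n : ℕ) :
    β * moment α (β - 1) t (orthoPoly α β t n * orthoPoly α β t n) =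
      (2 * n + 1 + α + β) * sqNorm α β n t +
      t * moment (α - 1) β t (orthoPoly α β t n * orthoPoly α β t n) := by
  have h1 := moment_integration_by_parts α hβ ht (X * (orthoPoly α β t n * orthoPoly α β t n))
  have h2 : moment α β t (orthoPoly α β t n * (X * derivative (orthoPoly α β t n))) =
      n * sqNorm α β n t := by
    rw [moment_orthoPoly_mul hα hβ ht n]
    · cases n with
      | zero => simp
      | succ n => rw [coeff_X_mul, coeff_derivative, coeff_orthoPoly_self]; push_cast; ring
    · refine degree_lt_of_coeff fun k hk => ?_
      obtain ⟨k, rfl⟩ : ∃ j, k = j + 1 := ⟨k - 1, by omega⟩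
      rw [coeff_X_mul, coeff_derivative, coeff_orthoPoly_of_lt α β t (by omega), zero_mul]
  have e : derivative (X * (orthoPoly α β t n * orthoPoly α β t n)) =
      orthoPoly α β t n * orthoPoly α β t n +
      C 2 * (orthoPoly α β t n * (X * derivative (orthoPoly α β t n))) := by
    simp only [derivative_mul, derivative_X, map_ofNat]; ring
  rw [e, moment_add _ (by linarith) ht, moment_C_mul, h2, moment_X_mul, moment_X_mul,
    moment_pred_right_X_mul α hβ ht, ← sqNorm_eq_moment] at h1
  linarith

/-- `∫ v'(x) P_{n+1} P_n w dx = (n+1) h_n`. -/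
theorem sum_rule_consecutive (n : ℕ) :
    β * moment α (β - 1) t (orthoPoly α β t (n + 1) * orthoPoly α β t n) =
      (n + 1) * sqNorm α β n t +
      t * moment (α - 1 - 1) β t (orthoPoly α β t (n + 1) * orthoPoly α β t n) +
      α * moment (α - 1) β t (orthoPoly α β t (n + 1) * orthoPoly α β t n) := by
  have h1 := moment_integration_by_parts α hβ ht (orthoPoly α β t (n + 1) * orthoPoly α β t n)
  have h2 : moment α β t (orthoPoly α β t n * derivative (orthoPoly α β t (n + 1))) =
      (n + 1) * sqNorm α β n t := by
    rw [moment_orthoPoly_mul hα hβ ht n]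
    · rw [coeff_derivative, coeff_orthoPoly_self]; ring
    · refine degree_lt_of_coeff fun k hk => ?_
      rw [coeff_derivative, coeff_orthoPoly_of_lt α β t (by omega), zero_mul]
  have h3 : moment α β t (orthoPoly α β t (n + 1) * derivative (orthoPoly α β t n)) = 0 := by
    refine moment_orthoPoly_mul_eq_zero hα hβ ht (n + 1) (degree_lt_of_coeff fun k hk => ?_)
    rw [coeff_derivative, coeff_orthoPoly_of_lt α β t (by omega), zero_mul]
  have e : derivative (orthoPoly α β t (n + 1) * orthoPoly α β t n) =
      orthoPoly α β t n * derivative (orthoPoly α β t (n + 1)) +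
      orthoPoly α β t (n + 1) * derivative (orthoPoly α β t n) := by
    rw [derivative_mul]; ring
  rw [e, moment_add _ (by linarith) ht, h2, h3] at h1
  linarith

/-- `∫ x v'(x) P_{n+1} P_n w dx = -c h_n`, where `c` is the subleading coefficient of `P_{n+1}`. -/
theorem sum_rule_X_mul_consecutive (n : ℕ) :
    β * moment α (β - 1) t (orthoPoly α β t (n + 1) * orthoPoly α β t n) =
      -(orthoPoly α β t (n + 1)).coeff n * sqNorm α β n t +
      t * moment (α - 1) β t (orthoPoly α β t (n + 1) * orthoPoly α β t n) := by
  have h1 := moment_integration_by_parts α hβ ht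
    (X * (orthoPoly α β t (n + 1) * orthoPoly α β t n))
  have h0 : moment α β t (orthoPoly α β t (n + 1) * orthoPoly α β t n) = 0 :=
    moment_orthoPoly_mul_eq_zero hα hβ ht (n + 1) (degree_orthoPoly_lt α β t n.lt_succ_self)
  -- Subtracting (n+1) P_{n+1} cancels the leading term of x P_{n+1}', so the degree is at most n.
  -- The coefficient of x^n is n c - (n+1) c = -c.
  have h2 : moment α β t (orthoPoly α β t n * (X * derivative (orthoPoly α β t (n + 1)) -
      C ((n : ℝ) + 1) * orthoPoly α β t (n + 1))) =
      -(orthoPoly α β t (n + 1)).coeff n * sqNorm α β n t := by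
    rw [moment_orthoPoly_mul hα hβ ht n]
    · congr 1
      cases n with
      | zero => simp
      | succ n =>
        rw [coeff_sub, coeff_X_mul, coeff_derivative, coeff_C_mul]; push_cast; ring
    · refine degree_lt_of_coeff fun k hk => ?_
      obtain ⟨k, rfl⟩ : ∃ j, k = j + 1 := ⟨k - 1, by omega⟩
      rw [coeff_sub, coeff_X_mul, coeff_derivative, coeff_C_mul]
      rcases (by omega : n = k ∨ n < k) with rfl | h
      · rw [coeff_orthoPoly_self]; ring
      · rw [coeff_orthoPoly_of_lt α β t (by omega)]; ring
  have h3 : moment α β t (orthoPoly α β t (n + 1) * (X * derivative (orthoPoly α β t n))) = 0 := by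
    refine moment_orthoPoly_mul_eq_zero hα hβ ht (n + 1) (degree_lt_of_coeff fun k hk => ?_)
    obtain ⟨k, rfl⟩ : ∃ j, k = j + 1 := ⟨k - 1, by omega⟩
    rw [coeff_X_mul, coeff_derivative, coeff_orthoPoly_of_lt α β t (by omega), zero_mul]
  have e : derivative (X * (orthoPoly α β t (n + 1) * orthoPoly α β t n)) =
      C ((n : ℝ) + 2) * (orthoPoly α β t (n + 1) * orthoPoly α β t n) +
      (orthoPoly α β t n * (X * derivative (orthoPoly α β t (n + 1)) -
        C ((n : ℝ) + 1) * orthoPoly α β t (n + 1)) +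
      orthoPoly α β t (n + 1) * (X * derivative (orthoPoly α β t n))) := by
    simp only [derivative_mul, derivative_X, map_add, map_one, map_ofNat]; ring
  have hb : -1 < β := by linarith
  rw [e, moment_add _ hb ht, moment_add _ hb ht, moment_C_mul, h2, h3, moment_X_mul, moment_X_mul,
    moment_pred_right_X_mul α hβ ht, h0] at h1
  linarith

end Relations

/-! ### Coefficientwise differentiation in t. -/

/-- The polynomials `p s` have bounded degree and their coefficients are differentiable in `s` at
`t`, with derivatives the coefficients of `p'`. -/
def HasCoeffDerivAt (p : ℝ → ℝ[X]) (p' : ℝ[X]) (t : ℝ) : Prop :=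
  (∃ d, ∀ s, (p s).natDegree ≤ d) ∧ ∀ k, HasDerivAt (fun s => (p s).coeff k) (p'.coeff k) t

theorem hasCoeffDerivAt_const (p : ℝ[X]) (t : ℝ) : HasCoeffDerivAt (fun _ => p) 0 t :=
  ⟨⟨p.natDegree, fun _ => le_rfl⟩, fun k => by
    rw [coeff_zero]
    exact hasDerivAt_const _ _⟩

theorem HasCoeffDerivAt.sub {p q : ℝ → ℝ[X]} {p' q' : ℝ[X]} {t : ℝ} (hp : HasCoeffDerivAt p p' t)
    (hq : HasCoeffDerivAt q q' t) : HasCoeffDerivAt (fun s => p s - q s) (p' - q') t := by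
  obtain ⟨⟨d, hd⟩, hp⟩ := hp
  obtain ⟨⟨e, he⟩, hq⟩ := hq
  refine ⟨⟨max d e, fun s => (natDegree_sub_le _ _).trans (max_le_max (hd s) (he s))⟩, fun k => ?_⟩
  simp only [coeff_sub]
  exact (hp k).sub (hq k)

theorem HasCoeffDerivAt.add {p q : ℝ → ℝ[X]} {p' q' : ℝ[X]} {t : ℝ} (hp : HasCoeffDerivAt p p' t)
    (hq : HasCoeffDerivAt q q' t) : HasCoeffDerivAt (fun s => p s + q s) (p' + q') t := by
  obtain ⟨⟨d, hd⟩, hp⟩ := hp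
  obtain ⟨⟨e, he⟩, hq⟩ := hq
  refine ⟨⟨max d e, fun s => (natDegree_add_le _ _).trans (max_le_max (hd s) (he s))⟩, fun k => ?_⟩
  simp only [coeff_add]
  exact (hp k).add (hq k)

theorem HasCoeffDerivAt.mul {p q : ℝ → ℝ[X]} {p' q' : ℝ[X]} {t : ℝ} (hp : HasCoeffDerivAt p p' t)
    (hq : HasCoeffDerivAt q q' t) :
    HasCoeffDerivAt (fun s => p s * q s) (p' * q t + p t * q') t := by
  obtain ⟨⟨d, hd⟩, hp⟩ := hp
  obtain ⟨⟨e, he⟩, hq⟩ := hq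
  refine ⟨⟨d + e, fun s => natDegree_mul_le.trans (add_le_add (hd s) (he s))⟩, fun k => ?_⟩
  simp only [coeff_mul, coeff_add, ← Finset.sum_add_distrib]
  exact HasDerivAt.fun_sum fun i _ => (hp i.1).mul (hq i.2)

theorem hasCoeffDerivAt_C {f : ℝ → ℝ} {f' t : ℝ} (hf : HasDerivAt f f' t) :
    HasCoeffDerivAt (fun s => C (f s)) (C f') t := by
  refine ⟨⟨0, fun s => (natDegree_C _).le⟩, fun k => ?_⟩
  cases k with
  | zero => simpa using hf
  | succ k => simpa [coeff_C_succ] using hasDerivAt_const t (0 : ℝ)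

theorem exists_hasCoeffDerivAt_sum {ι : Type*} {t : ℝ} (s : Finset ι) (p : ι → ℝ → ℝ[X])
    (hp : ∀ i ∈ s, ∃ p', HasCoeffDerivAt (p i) p' t) :
    ∃ p', HasCoeffDerivAt (fun u => ∑ i ∈ s, p i u) p' t := by
  classical
  induction s using Finset.induction_on with
  | empty => exact ⟨0, by simpa using hasCoeffDerivAt_const 0 t⟩
  | insert i s hi ih =>
    obtain ⟨q', hq⟩ := hp i (Finset.mem_insert_self i s)
    obtain ⟨p', hp'⟩ := ih fun j hj => hp j (Finset.mem_insert_of_mem hj)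
    exact ⟨q' + p', by simpa only [Finset.sum_insert hi] using hq.add hp'⟩

theorem moment_eq_sum_coeff (a : ℝ) {b t : ℝ} (hb : -1 < b) (ht : 0 < t) {p : ℝ[X]} {d : ℕ}
    (hd : p.natDegree ≤ d) :
    moment a b t p = ∑ k ∈ Finset.range (d + 1), p.coeff k * moment a b t (X ^ k) := by
  conv_lhs => rw [as_sum_range_C_mul_X_pow' (p := p) (n := d + 1) (by omega)]
  rw [moment_sum a hb ht]
  simp only [moment_C_mul]

/-- Product rule: one term from the coefficients of p, one from ∂w/∂t = -w/x. The degree bound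
reduces it to finitely many monomial moments. -/
theorem HasCoeffDerivAt.moment (a : ℝ) {b t : ℝ} (hb : -1 < b) (ht : 0 < t) {p : ℝ → ℝ[X]}
    {p' : ℝ[X]} (hp : HasCoeffDerivAt p p' t) :
    HasDerivAt (fun s => moment a b s (p s)) (moment a b t p' - moment (a - 1) b t (p t)) t := by
  obtain ⟨⟨d, hd⟩, hp⟩ := hp
  have hd' : p'.natDegree ≤ d := by
    rw [natDegree_le_iff_coeff_eq_zero]
    intro k hk
    refine (hp k).unique ?_
    have : (fun s => (p s).coeff k) = fun _ => 0 :=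
      funext fun s => coeff_eq_zero_of_natDegree_lt ((hd s).trans_lt hk)
    rw [this]
    exact hasDerivAt_const _ _
  have h1 : HasDerivAt (fun s => ∑ k ∈ Finset.range (d + 1),
      (p s).coeff k * PollaczekJacobi.moment a b s (X ^ k))
      (∑ k ∈ Finset.range (d + 1), (p'.coeff k * PollaczekJacobi.moment a b t (X ^ k) +
        (p t).coeff k * -PollaczekJacobi.moment (a - 1) b t (X ^ k))) t :=
    HasDerivAt.fun_sum fun k _ => (hp k).mul (hasDerivAt_moment a hb ht (X ^ k))
  have e : (fun s => PollaczekJacobi.moment a b s (p s)) =ᶠ[𝓝 t] fun s =>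
      ∑ k ∈ Finset.range (d + 1), (p s).coeff k * PollaczekJacobi.moment a b s (X ^ k) := by
    filter_upwards [lt_mem_nhds ht] with s hs using moment_eq_sum_coeff a hb hs (hd s)
  refine (h1.congr_of_eventuallyEq e).congr_deriv ?_
  rw [moment_eq_sum_coeff a hb ht hd', moment_eq_sum_coeff (a - 1) hb ht (hd t),
    Finset.sum_add_distrib]
  simp only [mul_neg, Finset.sum_neg_distrib, sub_eq_add_neg]

/-- By strong induction along Gram–Schmidt: the coefficients are quotients of differentiable moments
with nonzero denominators. -/
theorem exists_hasCoeffDerivAt_orthoPoly {α β t : ℝ} (hα : 0 < α) (hβ : 0 < β) (ht : 0 < t)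
    (n : ℕ) : ∃ P', HasCoeffDerivAt (fun s => orthoPoly α β s n) P' t := by
  have hb : -1 < β := by linarith
  induction n using Nat.strong_induction_on with
  | _ n ih =>
    have key : ∀ k ∈ (Finset.univ : Finset (Fin n)), ∃ p', HasCoeffDerivAt (fun s =>
        C (pairing α β s (X ^ n) (orthoPoly α β s k) /
          pairing α β s (orthoPoly α β s k) (orthoPoly α β s k)) * orthoPoly α β s k) p' t := by
      intro k _
      obtain ⟨P', hP⟩ := ih k k.2
      have h1 := ((hasCoeffDerivAt_const (X ^ n) t).mul hP).moment α hb ht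
      have h2 := (hP.mul hP).moment α hb ht
      have h3 : moment α β t (orthoPoly α β t k * orthoPoly α β t k) ≠ 0 := by
        rw [← sqNorm_eq_moment]
        exact (sqNorm_pos hα hβ ht.le _).ne'
      simp only [pairing_eq_moment]
      exact ⟨_, (hasCoeffDerivAt_C (h1.div h2 h3)).mul hP⟩
    obtain ⟨p', hp⟩ := exists_hasCoeffDerivAt_sum _ _ key
    refine ⟨0 - p', ?_⟩
    have h := (hasCoeffDerivAt_const (X ^ n) t).sub hp
    have e : (fun s => orthoPoly α β s n) = fun s => X ^ n - ∑ k : Fin n,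
        C (pairing α β s (X ^ n) (orthoPoly α β s k) /
          pairing α β s (orthoPoly α β s k) (orthoPoly α β s k)) * orthoPoly α β s k :=
      funext fun s => by rw [orthoPoly]
    rw [e]
    exact h

/-! ### The t-derivative of P_n and of its norm. -/

/-- A coefficientwise `t`-derivative of `P_n`. -/
def orthoPolyDeriv (α β t : ℝ) (n : ℕ) : ℝ[X] :=
  open Classical in
  if h : ∃ P', HasCoeffDerivAt (fun s => orthoPoly α β s n) P' t then h.choose else 0

section Derivatives

variable {α β t : ℝ} (hα : 0 < α) (hβ : 0 < β) (ht : 0 < t)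

include hα hβ ht

theorem hasCoeffDerivAt_orthoPoly (n : ℕ) :
    HasCoeffDerivAt (fun s => orthoPoly α β s n) (orthoPolyDeriv α β t n) t := by
  have h := exists_hasCoeffDerivAt_orthoPoly hα hβ ht n
  rw [orthoPolyDeriv, dif_pos h]
  exact h.choose_spec

theorem degree_orthoPolyDeriv_lt (n : ℕ) : (orthoPolyDeriv α β t n).degree < n := by
  refine degree_lt_of_coeff fun k hk => ((hasCoeffDerivAt_orthoPoly hα hβ ht n).2 k).unique ?_
  -- P_n is monic of degree n for every s, so its coefficients from index n on are constant.
  have : (fun s => (orthoPoly α β s n).coeff k) = fun _ => if k = n then 1 else 0 := by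
    funext s
    split_ifs with h
    · rw [h, coeff_orthoPoly_self]
    · exact coeff_orthoPoly_of_lt α β s (by omega)
  rw [this]
  exact hasDerivAt_const _ _

theorem moment_orthoPoly_mul_orthoPolyDeriv (n : ℕ) :
    moment α β t (orthoPoly α β t n * orthoPolyDeriv α β t n) = 0 :=
  moment_orthoPoly_mul_eq_zero hα hβ ht n (degree_orthoPolyDeriv_lt hα hβ ht n)

theorem hasDerivAt_sqNorm (n : ℕ) :
    HasDerivAt (sqNorm α β n)
      (-moment (α - 1) β t (orthoPoly α β t n * orthoPoly α β t n)) t := by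
  have hP := hasCoeffDerivAt_orthoPoly hα hβ ht n
  have h1 := (hP.mul hP).moment α (by linarith : -1 < β) ht
  have e : sqNorm α β n = fun s => moment α β s (orthoPoly α β s n * orthoPoly α β s n) :=
    funext fun s => sqNorm_eq_moment α β n s
  rw [e]
  refine h1.congr_deriv ?_
  rw [mul_comm (orthoPolyDeriv α β t n), moment_add _ (by linarith) ht,
    moment_orthoPoly_mul_orthoPolyDeriv hα hβ ht]
  ring

theorem hasDerivAt_moment_pred_right (n : ℕ) :
    HasDerivAt (fun s => moment α (β - 1) s (orthoPoly α β s n * orthoPoly α β s n))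
      (2 * moment α (β - 1) t (orthoPoly α β t n * orthoPolyDeriv α β t n) -
        (moment (α - 1) β t (orthoPoly α β t n * orthoPoly α β t n) +
          moment α (β - 1) t (orthoPoly α β t n * orthoPoly α β t n))) t := by
  have hP := hasCoeffDerivAt_orthoPoly hα hβ ht n
  have h1 := (hP.mul hP).moment α (by linarith : -1 < β - 1) ht
  refine h1.congr_deriv ?_
  rw [mul_comm (orthoPolyDeriv α β t n), moment_add _ (by linarith) ht,
    moment_partial_fraction α hβ ht]
  ring

/-- Differentiating ∫ P_n p w = 0 for fixed p gives ∫ (∂P_n/∂t) p w = ∫ P_n p w/x, and the latter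
sees only p(0). -/
theorem moment_orthoPolyDeriv_mul (n : ℕ) {p : ℝ[X]} (hp : p.degree < n) :
    moment α β t (orthoPolyDeriv α β t n * p) =
      p.coeff 0 * moment (α - 1) β t (orthoPoly α β t n) := by
  have hb : -1 < β := by linarith
  have h1 := ((hasCoeffDerivAt_orthoPoly hα hβ ht n).mul (hasCoeffDerivAt_const p t)).moment α hb ht
  have h2 : HasDerivAt (fun s => moment α β s (orthoPoly α β s n * p)) 0 t := by
    refine (hasDerivAt_const t (0 : ℝ)).congr_of_eventuallyEq ?_
    filter_upwards [lt_mem_nhds ht] with s hs using moment_orthoPoly_mul_eq_zero hα hβ hs n hp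
  have h3 := h1.unique h2
  have h4 : (n : WithBot ℕ) < ((n + 1 + 1 : ℕ) : WithBot ℕ) := by
    exact_mod_cast (by omega : n < n + 1 + 1)
  rw [mul_zero, add_zero, moment_pred_orthoPoly_mul hα hβ ht n (hp.trans h4),
    (degree_lt_iff_coeff_zero p n).1 hp (n + 1) (by omega)] at h3
  linarith

/-- The leading coefficient of `∂P_{n+1}/∂t`. -/
theorem coeff_orthoPolyDeriv (n : ℕ) :
    (orthoPolyDeriv α β t (n + 1)).coeff n =
      (orthoPoly α β t n).coeff 0 * moment (α - 1) β t (orthoPoly α β t (n + 1)) /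
        sqNorm α β n t := by
  have h1 := moment_orthoPolyDeriv_mul hα hβ ht (n + 1) (degree_orthoPoly_lt α β t n.lt_succ_self)
  rw [mul_comm, moment_orthoPoly_mul hα hβ ht n (degree_orthoPolyDeriv_lt hα hβ ht (n + 1))] at h1
  rw [← h1, mul_div_cancel_right₀ _ (sqNorm_pos hα hβ ht.le n).ne']

/-- `x ∂P_{n+1}/∂t` is a combination of `P_{n+1}` and `P_n`. -/
theorem X_mul_orthoPolyDeriv (n : ℕ) :
    X * orthoPolyDeriv α β t (n + 1) =
      C ((orthoPoly α β t n).coeff 0 * moment (α - 1) β t (orthoPoly α β t (n + 1)) /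
        sqNorm α β n t) * orthoPoly α β t (n + 1) -
      C ((orthoPoly α β t (n + 1)).coeff 0 * moment (α - 1) β t (orthoPoly α β t (n + 1)) /
        sqNorm α β n t) * orthoPoly α β t n := by
  have hb : -1 < β := by linarith
  have hh := (sqNorm_pos hα hβ ht.le n).ne'
  have hlead := coeff_orthoPolyDeriv hα hβ ht n
  set u := (orthoPoly α β t n).coeff 0 * moment (α - 1) β t (orthoPoly α β t (n + 1)) /
    sqNorm α β n t
  set v := (orthoPoly α β t (n + 1)).coeff 0 * moment (α - 1) β t (orthoPoly α β t (n + 1)) /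
    sqNorm α β n t with hv
  set D := orthoPolyDeriv α β t (n + 1)
  have hD := (degree_lt_iff_coeff_zero D (n + 1)).1 (degree_orthoPolyDeriv_lt hα hβ ht (n + 1))
  -- The difference E of the two sides has degree at most n and is orthogonal to every polynomial of
  -- degree at most n. Hence ∫ E² w = 0 and E = 0.
  set E := X * D - (C u * orthoPoly α β t (n + 1) - C v * orthoPoly α β t n) with hE
  have hdeg : E.degree < ((n + 1 : ℕ) : WithBot ℕ) := by
    refine degree_lt_of_coeff fun k hk => ?_
    obtain ⟨k, rfl⟩ : ∃ j, k = j + 1 := ⟨k - 1, by omega⟩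
    rw [hE, coeff_sub, coeff_sub, coeff_X_mul, coeff_C_mul, coeff_C_mul,
      coeff_orthoPoly_of_lt α β t (by omega : n < k + 1)]
    rcases (by omega : n = k ∨ n + 1 ≤ k) with rfl | h
    · rw [hlead, coeff_orthoPoly_self]; ring
    · rw [hD k h, coeff_orthoPoly_of_lt α β t (by omega)]; ring
  have horth : ∀ p : ℝ[X], p.degree < ((n + 1 : ℕ) : WithBot ℕ) → moment α β t (E * p) = 0 := by
    intro p hp
    -- x p may have degree n + 1, one too many for `moment_orthoPolyDeriv_mul`. Removing its
    -- component along P_{n+1} costs nothing, as that is orthogonal to D.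
    have hXp : (X * p - C (p.coeff n) * orthoPoly α β t (n + 1)).degree <
        ((n + 1 : ℕ) : WithBot ℕ) := by
      have := degree_sub_orthoPoly_lt α β t (p := X * p) (n := n + 1) (degree_lt_of_coeff
        fun k hk => by
          obtain ⟨k, rfl⟩ : ∃ j, k = j + 1 := ⟨k - 1, by omega⟩
          rw [coeff_X_mul]
          exact (degree_lt_iff_coeff_zero p (n + 1)).1 hp k (by omega))
      rwa [coeff_X_mul] at this
    have h1 := moment_orthoPolyDeriv_mul hα hβ ht (n + 1) hXp
    have h2 := moment_orthoPoly_mul_orthoPolyDeriv hα hβ ht (n + 1)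
    have h3 := moment_orthoPoly_mul hα hβ ht n hp
    have h4 := moment_orthoPoly_mul_eq_zero hα hβ ht (n + 1) hp
    rw [coeff_sub, coeff_C_mul, mul_coeff_zero, coeff_X_zero] at h1
    have e : E * p = D * (X * p - C (p.coeff n) * orthoPoly α β t (n + 1)) +
        (C (p.coeff n) * (orthoPoly α β t (n + 1) * D) -
        (C u * (orthoPoly α β t (n + 1) * p) - C v * (orthoPoly α β t n * p))) := by
      rw [hE]; ring
    rw [e, moment_add _ hb ht, moment_sub _ hb ht, moment_sub _ hb ht, moment_C_mul, moment_C_mul,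
      moment_C_mul, h1, h2, h3, h4, hv]
    field_simp
    ring
  have hE0 : E = 0 := by
    by_contra hne
    have h1 := pairing_self_pos hα hβ ht.le hne
    rw [pairing_eq_moment, horth E hdeg] at h1
    exact lt_irrefl _ h1
  exact sub_eq_zero.1 hE0

end Derivatives

/-! ### Pure algebra: elimination, and reduction of the system to P_V. -/

/-- Elimination of the recurrence coefficients and of the quantities of index `n - 1`: `p`, `P`
stand for two consecutive orthogonal polynomials, `h`, `H` for their square norms. -/
theorem algebraic_relations {α β t ν N h H p0 dp p1 P0 dP P1 qp q2p Qp qP q2P QP ρ R r R₁ : ℝ}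
    (hh : h ≠ 0) (hH : H ≠ 0) (hN : N = 2 * ν + 1 + α + β)
    (w0 : P0 * qp + h = p0 * qP) (w1 : P1 * Qp - h = p1 * QP)
    (w2 : P0 * q2p + dP * qp = p0 * q2P + dp * qP)
    (a1 : t * (P0 * q2P + dP * qP) + α * (P0 * qP) = β * (P1 * QP))
    (a2 : t * (p0 * q2p + dp * qp) + α * (p0 * qp) = β * (p1 * Qp))
    (b1 : β * (P1 * QP) = N * H + t * (P0 * qP))
    (b2 : β * (p1 * Qp) = (N - 2) * h + t * (p0 * qp))
    (c : β * (p1 * QP) = ν * h + t * (p0 * q2P + dp * qP) + α * (p0 * qP))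
    (d : β * (p1 * QP) = -ρ * h + t * (p0 * qP))
    (hR : R = β * (P1 * QP) / H) (hr : r = β * (p1 * QP) / h) (hR₁ : R₁ = β * (p1 * Qp) / h) :
    R * (H / h) * R₁ = r ^ 2 + β * r ∧
    N * (N - 2) * (H / h) =
      ρ ^ 2 + (N - 1 - β) * ρ + (N - 1) * r - t * ρ - t * ν ∧
    2 * (r ^ 2 + β * r) * R * N - N ^ 2 * (r ^ 2 + β * r) -
      R ^ 2 * (ρ ^ 2 + 2 * ν * (r + ρ) - t * ρ - t * ν + α * (r + ρ) + β * r) -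
      N * R * ((2 * (r + ρ) - t) * (r - ν) - α * (r + ρ)) = 0 := by
  have hRH : R * H = β * (P1 * QP) := by rw [hR]; field_simp
  have hrh : r * h = β * (p1 * QP) := by rw [hr]; field_simp
  have hR₁h : R₁ * h = β * (p1 * Qp) := by rw [hR₁]; field_simp
  have ha : (R - N) * H = t * (P0 * qP) := by linear_combination hRH + b1
  have ha₁ : (R₁ - N + 2) * h = t * (p0 * qp) := by linear_combination hR₁h + b2
  have hx : (r + ρ) * h = t * (p0 * qP) := by linear_combination hrh + d
  have hrs : (r - ν) * h = t * (p0 * q2P + dp * qP) + α * (p0 * qP) := by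
    linear_combination hrh + c
  have hRs : R * H = t * (P0 * q2P + dP * qP) + α * (P0 * qP) := by linear_combination hRH - a1
  have hR₁s : R₁ * h = t * (p0 * q2p + dp * qp) + α * (p0 * qp) := by
    linear_combination hR₁h - a2
  obtain ⟨b, hb⟩ : ∃ b, b = H / h := ⟨_, rfl⟩
  have hbh : b * h = H := by rw [hb]; field_simp
  have h2 : h ^ 2 ≠ 0 := pow_ne_zero 2 hh
  rw [← hb]
  -- For `e1`, `e2`, `e3`: a product of diagonal terms such as (P0 qP)(p0 qp) is also the product of
  -- mixed terms (P0 qp)(p0 qP). The relations `w0`, `w1`, `w2` then express everything through r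
  -- and ρ.
  have e1 : R * b * R₁ = r ^ 2 + β * r := by
    apply mul_right_cancel₀ h2
    linear_combination R * R₁ * h * hbh + R₁ * h * hRH + β * (P1 * QP) * hR₁h -
      (r * h + β * h + β * (p1 * QP)) * hrh + β ^ 2 * p1 * QP * w1
  have e2 : b * (R - N) * (R₁ - N + 2) = (r + ρ) ^ 2 - t * (r + ρ) := by
    apply mul_right_cancel₀ h2
    linear_combination (R - N) * (R₁ - N + 2) * h * hbh + (R₁ - N + 2) * h * ha +
      t * (P0 * qP) * ha₁ - ((r + ρ) * h + t * (p0 * qP) - t * h) * hx + t ^ 2 * (p0 * qP) * w0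
  have e3 : b * ((R - N) * R₁ + R * (R₁ - N + 2)) =
      (2 * (r + ρ) - t) * (r - ν) - α * (r + ρ) := by
    apply mul_right_cancel₀ h2
    linear_combination ((R - N) * R₁ + R * (R₁ - N + 2)) * h * hbh + R₁ * h * ha +
      t * (P0 * qP) * hR₁s + (R₁ - N + 2) * h * hRs + (t * (P0 * q2P + dP * qP) + α * (P0 * qP)) * ha₁ -
      2 * ((r - ν) * h) * hx - (2 * (t * (p0 * qP)) - t * h) * hrs + α * h * hx +
      (2 * α * t * (p0 * qP) + t ^ 2 * (p0 * q2P + dp * qP)) * w0 + t ^ 2 * (p0 * qP) * w2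
  -- The left sides of `e1 + e2 - e3` combine to b (R - (R-N)) (R₁ - (R₁-N+2)) = b N (N-2).
  have e4 : N * (N - 2) * b =
      ρ ^ 2 + (N - 1 - β) * ρ + (N - 1) * r - t * ρ - t * ν := by
    rw [hN] at e2 e3 ⊢
    linear_combination e1 + e2 - e3
  refine ⟨e1, e4, ?_⟩
  subst hN
  -- In N R times `e3`, the unknowns b and R₁ occur only through R b R₁ and N (N-2) b, which `e1`
  -- and `e4` supply.
  linear_combination (2 * ν + 1 + α + β) * R * e3 -
    (2 * R * (2 * ν + 1 + α + β) - (2 * ν + 1 + α + β) ^ 2) * e1 + R ^ 2 * e4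

theorem painleveV_of_system {α β ν N : ℝ} (hN : N = 2 * ν + 1 + α + β) (hN1 : 1 < N)
    {R r ρ : ℝ → ℝ} (hR : ∀ t, 0 < t → N < R t)
    (dR : ∀ t, 0 < t → HasDerivAt R ((R t ^ 2 - (N + β + t) * R t + β * N + 2 * ρ t * R t +
      2 * N * r t) / t) t)
    (dρ : ∀ t, 0 < t → HasDerivAt ρ ((r t + ρ t) / t) t)
    (dr : ∀ t, 0 < t → ∃ r', HasDerivAt r (r' / t) t ∧
      (N - 1) * (R t * r') = N * (N - 2) * (r t ^ 2 + β * r t) -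
        R t * (R t - 2) * (ρ t ^ 2 + (N - 1 - β) * ρ t + (N - 1) * r t - t * ρ t - t * ν) -
        R t * ((2 * ρ t + N - 1 - β - t) * (r t + ρ t) - t * ρ t - t * ν))
    (hF : ∀ t, 0 < t → 2 * (r t ^ 2 + β * r t) * R t * N - N ^ 2 * (r t ^ 2 + β * r t) -
      R t ^ 2 * (ρ t ^ 2 + 2 * ν * (r t + ρ t) - t * ρ t - t * ν + α * (r t + ρ t) + β * r t) -
      N * R t * ((2 * (r t + ρ t) - t) * (r t - ν) - α * (r t + ρ t)) = 0) :
    SolvesPainleveV (N ^ 2 / 2) (-β ^ 2 / 2) α (-1 / 2) (fun t => R t / N) := by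
  intro t ht
  have hN0 : 0 < N := by linarith
  have hRt := hR t ht
  have d1 : ∀ s, 0 < s → HasDerivAt (fun t => R t / N) ((R s ^ 2 - (N + β + s) * R s + β * N +
      2 * ρ s * R s + 2 * N * r s) / s / N) s := fun s hs => (dR s hs).div_const N
  have ev : deriv (fun t => R t / N) =ᶠ[𝓝 t] fun s => (R s ^ 2 - (N + β + s) * R s + β * N +
      2 * ρ s * R s + 2 * N * r s) / s / N := by
    filter_upwards [lt_mem_nhds ht] with s hs using (d1 s hs).deriv
  obtain ⟨r', dr', hr'⟩ := dr t ht
  have hF := hF t ht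
  have d2 := ((((((dR t ht).pow 2).sub ((((hasDerivAt_id t).const_add (N + β))).mul (dR t ht))).add
    (hasDerivAt_const t (β * N))).add (((dρ t ht).const_mul 2).mul (dR t ht))).add
    (dr'.const_mul (2 * N))).div (hasDerivAt_id t) ht.ne' |>.div_const N
  have d3 := d2.congr_of_eventuallyEq ev
  have v1 := (d1 t ht).deriv
  have v2 := d3.deriv
  refine ⟨(div_pos (hN0.trans hRt) hN0).ne', ?_, (d1 t ht).differentiableAt,
    d3.differentiableAt, ?_⟩
  · rw [Ne, div_eq_one_iff_eq hN0.ne']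
    exact hRt.ne'
  rw [v2, v1]
  simp only [id, Pi.pow_apply, Pi.mul_apply, Pi.add_apply, Pi.sub_apply]
  clear v1 v2 d1 d2 d3 ev dR dρ dr dr' hR
  generalize R t = R at *
  generalize r t = r at *
  generalize ρ t = ρ at *
  have hR0 : R ≠ 0 := (hN0.trans hRt).ne'
  have hRN : R - N ≠ 0 := (sub_pos.2 hRt).ne'
  -- V = t R' and W = t V', so R'' = (W - V)/t².
  obtain ⟨V, hV⟩ : ∃ V, V = R ^ 2 - (N + β + t) * R + β * N + 2 * ρ * R + 2 * N * r := ⟨_, rfl⟩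
  obtain ⟨W, hW⟩ : ∃ W, W = V * (2 * R - (N + β + t) + 2 * ρ) - t * R + 2 * (r + ρ) * R +
    2 * N * r' := ⟨_, rfl⟩
  -- This is P_V for R/N with denominators cleared. `hr'` determines only (N-1) R r', so the factor
  -- N - 1 > 0 is inserted and cancelled.
  have key : W * (2 * R * (R - N)) = (3 * R - N) * V ^ 2 + (R - N) ^ 3 * (R ^ 2 - β ^ 2) +
      2 * α * t * R ^ 2 * (R - N) - t ^ 2 * R ^ 2 * (R + N) := by
    apply mul_left_cancel₀ (sub_pos.2 hN1).ne'
    rw [hW, hV]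
    subst hN
    linear_combination 4 * ((2 * (2 * ν + 1 + α + β) - 1) * R - (2 * ν + 1 + α + β)) * hF +
      4 * (2 * ν + 1 + α + β) * (R - (2 * ν + 1 + α + β)) * hr'
  rw [← hV]
  have hN0' := hN0.ne'
  have ht0 := ht.ne'
  have hRN' : R / N - 1 ≠ 0 := by
    rw [div_sub_one hN0']
    exact div_ne_zero hRN hN0'
  trans (W - V) / (t ^ 2 * N)
  · rw [hW]
    field_simp
    ring
  · rw [div_sub_one hN0']
    field_simp
    linear_combination key

/-! ### The relations and the differential system for R, r, ρ. -/

theorem moment_pred_sq_pos {α β t : ℝ} (hα : 0 < α) (hβ : 0 < β) (ht : 0 < t) {p : ℝ[X]}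
    (hp : p ≠ 0) : 0 < moment (α - 1) β t (p * p) := by
  have hb : -1 < β := by linarith
  have h1 := pairing_self_pos hα hβ ht.le hp
  rw [pairing_eq_moment] at h1
  have e : p * p = X * (p * p) + (1 - X) * (p * p) := by ring
  have h2 : 0 ≤ moment (α - 1) β t ((1 - X) * (p * p)) := by
    refine intervalIntegral.integral_nonneg zero_le_one fun x hx => ?_
    simp only [eval_mul, eval_sub, eval_one, eval_X]
    have h3 : 0 ≤ 1 - x := by linarith [hx.2]
    exact mul_nonneg (mul_nonneg h3 (mul_self_nonneg _)) (mul_nonneg (mul_nonneg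
      (Real.exp_pos _).le (Real.rpow_nonneg hx.1 _)) (Real.rpow_nonneg h3 _))
  rw [e, moment_add _ hb ht, moment_X_mul]
  linarith

theorem moment_pred_sq {α β t : ℝ} (hα : 0 < α) (hβ : 0 < β) (ht : 0 < t) (n : ℕ) :
    moment (α - 1) β t (orthoPoly α β t n * orthoPoly α β t n) =
      (orthoPoly α β t n).coeff 0 * moment (α - 1) β t (orthoPoly α β t n) := by
  rw [moment_pred_orthoPoly_mul hα hβ ht n (degree_orthoPoly_lt α β t (by omega)),
    coeff_orthoPoly_of_lt α β t n.lt_succ_self]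
  ring

theorem moment_pred_pred_sq {α β t : ℝ} (hα : 0 < α) (hβ : 0 < β) (ht : 0 < t) (n : ℕ) :
    moment (α - 1 - 1) β t (orthoPoly α β t n * orthoPoly α β t n) =
      (orthoPoly α β t n).coeff 0 * moment (α - 1 - 1) β t (orthoPoly α β t n) +
      (orthoPoly α β t n).coeff 1 * moment (α - 1) β t (orthoPoly α β t n) :=
  moment_pred_pred_orthoPoly_mul hα hβ ht n (degree_orthoPoly_lt α β t (by omega))

theorem moment_pred_right_sq {α β t : ℝ} (hα : 0 < α) (hβ : 0 < β) (ht : 0 < t) (n : ℕ) :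
    moment α (β - 1) t (orthoPoly α β t n * orthoPoly α β t n) =
      (orthoPoly α β t n).eval 1 * moment α (β - 1) t (orthoPoly α β t n) := by
  rw [moment_pred_right_orthoPoly_mul hα hβ ht n (degree_orthoPoly_lt α β t (by omega)),
    coeff_orthoPoly_of_lt α β t n.lt_succ_self]
  ring

/-- The second sum rule reads R_n - (2n+1+α+β) = (t/h_n) ∫ P_n² w/x, which is positive. -/
theorem lt_auxR {α β t : ℝ} (hα : 0 < α) (hβ : 0 < β) (ht : 0 < t) (n : ℕ) :
    2 * (n : ℝ) + 1 + α + β < auxR α β n t := by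
  have h1 := sum_rule_X_mul_sq hα hβ ht n
  have h2 := moment_pred_sq_pos hα hβ ht (orthoPoly_monic α β t n).ne_zero
  have h3 := sqNorm_pos hα hβ ht.le n
  rw [auxR_eq_moment, div_mul_eq_mul_div, lt_div_iff₀ h3, h1]
  have := mul_pos ht h2
  linarith

/-- `β h_n⁻¹ ∫ P_{n+1} P_n w dx / (1 - x)`. -/
def auxr (α β : ℝ) (n : ℕ) (t : ℝ) : ℝ :=
  β * moment α (β - 1) t (orthoPoly α β t (n + 1) * orthoPoly α β t n) / sqNorm α β n t

section Succ

variable {α β t : ℝ} (hα : 0 < α) (hβ : 0 < β) (ht : 0 < t)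

include hα hβ ht

theorem moment_pred_right_consecutive (n : ℕ) :
    moment α (β - 1) t (orthoPoly α β t (n + 1) * orthoPoly α β t n) =
      (orthoPoly α β t n).eval 1 * moment α (β - 1) t (orthoPoly α β t (n + 1)) := by
  rw [moment_pred_right_orthoPoly_mul hα hβ ht (n + 1) (degree_orthoPoly_lt α β t (by omega)),
    coeff_orthoPoly_of_lt α β t (by omega)]
  ring

theorem moment_pred_consecutive (n : ℕ) :
    moment (α - 1) β t (orthoPoly α β t (n + 1) * orthoPoly α β t n) =
      (orthoPoly α β t n).coeff 0 * moment (α - 1) β t (orthoPoly α β t (n + 1)) := by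
  rw [moment_pred_orthoPoly_mul hα hβ ht (n + 1) (degree_orthoPoly_lt α β t (by omega)),
    coeff_orthoPoly_of_lt α β t (by omega : n < n + 1 + 1)]
  ring

theorem auxr_add_coeff (n : ℕ) :
    auxr α β n t + (orthoPoly α β t (n + 1)).coeff n =
      t * ((orthoPoly α β t n).coeff 0 * moment (α - 1) β t (orthoPoly α β t (n + 1)) /
        sqNorm α β n t) := by
  have h := sum_rule_X_mul_consecutive hα hβ ht n
  have hh := (sqNorm_pos hα hβ ht.le n).ne'
  rw [auxr, h, moment_pred_consecutive hα hβ ht]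
  field_simp
  ring

theorem auxR_relations (n : ℕ) {N : ℝ} (hN : N = 2 * ((n : ℝ) + 1) + 1 + α + β) :
    auxR α β (n + 1) t * (sqNorm α β (n + 1) t / sqNorm α β n t) * auxR α β n t =
      auxr α β n t ^ 2 + β * auxr α β n t ∧
    N * (N - 2) * (sqNorm α β (n + 1) t / sqNorm α β n t) =
      (orthoPoly α β t (n + 1)).coeff n ^ 2 + (N - 1 - β) * (orthoPoly α β t (n + 1)).coeff n +
        (N - 1) * auxr α β n t - t * (orthoPoly α β t (n + 1)).coeff n - t * ((n : ℝ) + 1) ∧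
    2 * (auxr α β n t ^ 2 + β * auxr α β n t) * auxR α β (n + 1) t * N -
      N ^ 2 * (auxr α β n t ^ 2 + β * auxr α β n t) -
      auxR α β (n + 1) t ^ 2 * ((orthoPoly α β t (n + 1)).coeff n ^ 2 +
        2 * ((n : ℝ) + 1) * (auxr α β n t + (orthoPoly α β t (n + 1)).coeff n) -
        t * (orthoPoly α β t (n + 1)).coeff n - t * ((n : ℝ) + 1) +
        α * (auxr α β n t + (orthoPoly α β t (n + 1)).coeff n) + β * auxr α β n t) -
      N * auxR α β (n + 1) t *
        ((2 * (auxr α β n t + (orthoPoly α β t (n + 1)).coeff n) - t) *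
          (auxr α β n t - ((n : ℝ) + 1)) -
        α * (auxr α β n t + (orthoPoly α β t (n + 1)).coeff n)) = 0 := by
  have hd : (orthoPoly α β t (n + 1)).degree < ((n + 1 + 1 : ℕ) : WithBot ℕ) :=
    degree_orthoPoly_lt α β t (by omega)
  have hd' : (orthoPoly α β t n).degree < ((n + 1 + 1 + 1 : ℕ) : WithBot ℕ) :=
    degree_orthoPoly_lt α β t (by omega)
  have u0 := moment_pred_orthoPoly_mul hα hβ ht n hd
  have u1 := moment_pred_right_orthoPoly_mul hα hβ ht n hd
  have u2 := moment_pred_pred_orthoPoly_mul hα hβ ht n hd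
  rw [coeff_orthoPoly_self, mul_comm (orthoPoly α β t n)] at u0 u1
  rw [mul_comm (orthoPoly α β t n)] at u2
  have v0 := moment_pred_consecutive hα hβ ht n
  have v1 := moment_pred_right_consecutive hα hβ ht n
  have v2 := moment_pred_pred_orthoPoly_mul hα hβ ht (n + 1) hd'
  have c1 := sum_rule_sq hα hβ ht (n + 1)
  have c2 := sum_rule_sq hα hβ ht n
  have c3 := sum_rule_X_mul_sq hα hβ ht (n + 1)
  have c4 := sum_rule_X_mul_sq hα hβ ht n
  have c5 := sum_rule_consecutive hα hβ ht n
  have c6 := sum_rule_X_mul_consecutive hα hβ ht n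
  rw [moment_pred_pred_sq hα hβ ht, moment_pred_sq hα hβ ht, moment_pred_right_sq hα hβ ht]
    at c1 c2
  rw [moment_pred_sq hα hβ ht, moment_pred_right_sq hα hβ ht] at c3 c4
  rw [v0, v1, v2] at c5
  rw [v0, v1] at c6
  refine algebraic_relations (sqNorm_pos hα hβ ht.le n).ne' (sqNorm_pos hα hβ ht.le (n + 1)).ne'
    hN ?_ ?_ ?_ c1 c2 ?_ ?_ c5 c6 ?_ ?_ ?_
  -- Each of these three compares two evaluations of one integral of P_{n+1} P_n, reducing against
  -- P_n or against P_{n+1}.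
  · linear_combination v0 - u0
  · linear_combination v1 - u1
  · linear_combination v2 - u2
  · rw [c3, hN]; push_cast; ring
  · rw [c4, hN]; ring
  · rw [auxR_eq_moment, moment_pred_right_sq hα hβ ht]; ring
  · rw [auxr, v1]
  · rw [auxR_eq_moment, moment_pred_right_sq hα hβ ht]; ring

theorem auxR_mul_sqNorm (n : ℕ) :
    auxR α β n t * sqNorm α β n t = β * ((orthoPoly α β t n).eval 1 *
      moment α (β - 1) t (orthoPoly α β t n)) := by
  have hh := (sqNorm_pos hα hβ ht.le n).ne'
  rw [auxR_eq_moment, moment_pred_right_sq hα hβ ht]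
  field_simp

/-- ∂P_n/∂t enters only through its value at 1, its degree being too low to contribute more. The
remaining terms are quadratic in R_n by the sum rule. -/
theorem hasDerivAt_auxR (n : ℕ) :
    HasDerivAt (auxR α β n) (2 * β * ((orthoPolyDeriv α β t n).eval 1 *
      moment α (β - 1) t (orthoPoly α β t n)) / sqNorm α β n t +
      ((auxR α β n t - β) * (auxR α β n t - (2 * n + 1 + α + β)) - t * auxR α β n t) / t) t := by
  have hh := (sqNorm_pos hα hβ ht.le n).ne'
  have h1 := (((hasDerivAt_const t β).div (hasDerivAt_sqNorm hα hβ ht n) hh).mul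
    (hasDerivAt_moment_pred_right hα hβ ht n))
  have e : auxR α β n = fun s => β / sqNorm α β n s *
      moment α (β - 1) s (orthoPoly α β s n * orthoPoly α β s n) :=
    funext fun s => auxR_eq_moment α β n s
  have hd : (orthoPolyDeriv α β t n).degree < ((n + 1 + 1 : ℕ) : WithBot ℕ) :=
    (degree_orthoPolyDeriv_lt hα hβ ht n).trans (by exact_mod_cast (by omega : n < n + 1 + 1))
  have h2 := moment_pred_right_orthoPoly_mul hα hβ ht n hd
  rw [(degree_lt_iff_coeff_zero _ n).1 (degree_orthoPolyDeriv_lt hα hβ ht n) (n + 1) (by omega)]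
    at h2
  have h3 := sum_rule_X_mul_sq hα hβ ht n
  have h4 := auxR_mul_sqNorm hα hβ ht n
  rw [moment_pred_right_sq hα hβ ht, ← h4] at h3
  have h5 : moment (α - 1) β t (orthoPoly α β t n * orthoPoly α β t n) =
      (auxR α β n t - (2 * n + 1 + α + β)) * sqNorm α β n t / t := by
    field_simp
    linarith
  have h6 : moment α (β - 1) t (orthoPoly α β t n * orthoPoly α β t n) =
      auxR α β n t * sqNorm α β n t / β := by
    rw [h4, moment_pred_right_sq hα hβ ht]
    field_simp
  rw [h2, h5, h6] at h1
  refine (h1.congr_of_eventuallyEq (Eventually.of_forall (congrFun e))).congr_deriv ?_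
  rw [Pi.div_apply]
  have ht0 := ht.ne'
  field_simp
  ring

theorem hasDerivAt_coeff (n : ℕ) :
    HasDerivAt (fun s => (orthoPoly α β s (n + 1)).coeff n)
      ((auxr α β n t + (orthoPoly α β t (n + 1)).coeff n) / t) t := by
  refine ((hasCoeffDerivAt_orthoPoly hα hβ ht (n + 1)).2 n).congr_deriv ?_
  rw [coeff_orthoPolyDeriv hα hβ ht, auxr_add_coeff hα hβ ht, mul_div_cancel_left₀ _ ht.ne']

theorem hasDerivAt_auxR_succ (n : ℕ) {N : ℝ} (hN : N = 2 * ((n : ℝ) + 1) + 1 + α + β) :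
    HasDerivAt (auxR α β (n + 1)) ((auxR α β (n + 1) t ^ 2 - (N + β + t) * auxR α β (n + 1) t +
      β * N + 2 * (orthoPoly α β t (n + 1)).coeff n * auxR α β (n + 1) t +
      2 * N * auxr α β n t) / t) t := by
  refine (hasDerivAt_auxR hα hβ ht (n + 1)).congr_deriv ?_
  have hh := (sqNorm_pos hα hβ ht.le n).ne'
  have hH := (sqNorm_pos hα hβ ht.le (n + 1)).ne'
  -- At x = 1 the factor x disappears, so (∂P_{n+1}/∂t)(1) becomes a combination of P_{n+1}(1) and
  -- P_n(1).
  have h1 := congrArg (eval 1) (X_mul_orthoPolyDeriv hα hβ ht n)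
  have h2 := auxr_add_coeff hα hβ ht n
  have h3 := auxR_mul_sqNorm hα hβ ht (n + 1)
  have h4 := sum_rule_X_mul_sq hα hβ ht (n + 1)
  rw [moment_pred_right_sq hα hβ ht, moment_pred_sq hα hβ ht, ← h3] at h4
  have h5 : auxr α β n t * sqNorm α β n t = β * ((orthoPoly α β t n).eval 1 *
      moment α (β - 1) t (orthoPoly α β t (n + 1))) := by
    rw [auxr, div_mul_cancel₀ _ hh, moment_pred_right_consecutive hα hβ ht]
  simp only [eval_mul, eval_X, one_mul, eval_sub, eval_C] at h1
  rw [h1]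
  rw [hN]
  push_cast at h4 ⊢
  generalize moment (α - 1) β t (orthoPoly α β t (n + 1)) = q at *
  generalize moment α (β - 1) t (orthoPoly α β t (n + 1)) = Q at *
  generalize (orthoPoly α β t n).coeff 0 = p0 at *
  generalize (orthoPoly α β t (n + 1)).coeff 0 = P0 at *
  generalize (orthoPoly α β t n).eval 1 = p1 at *
  generalize (orthoPoly α β t (n + 1)).eval 1 = P1 at *
  generalize (orthoPoly α β t (n + 1)).coeff n = ρ at *
  generalize auxr α β n t = r at *
  generalize auxR α β (n + 1) t = R at *
  generalize sqNorm α β n t = h at *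
  generalize sqNorm α β (n + 1) t = H at *
  have h6 : t * (2 * β * ((p0 * q / h * P1 - P0 * q / h * p1) * Q) / H) =
      2 * ((r + ρ) * R - (R - (2 * ((n : ℝ) + 1) + 1 + α + β)) * r) := by
    have h7 : t * (P0 * q) = (R - (2 * ((n : ℝ) + 1) + 1 + α + β)) * H := by
      linear_combination -h4
    have h8 : t * (p0 * q) = (r + ρ) * h := by rw [h2]; field_simp
    field_simp
    linear_combination P1 * Q * β * h8 - p1 * Q * β * h7 - (r + ρ) * h * h3 +
      (R - (2 * ((n : ℝ) + 1) + 1 + α + β)) * H * h5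
  rw [eq_div_iff ht.ne', add_mul, mul_comm _ t, h6, div_mul_cancel₀ _ ht.ne']
  ring

/-- A Toda-type equation: t (log h_m)' = 2m+1+α+β - R_m, and the constants for n + 1 and n differ by
2. -/
theorem hasDerivAt_sqNorm_ratio (n : ℕ) :
    HasDerivAt (fun s => sqNorm α β (n + 1) s / sqNorm α β n s)
      (sqNorm α β (n + 1) t / sqNorm α β n t *
        (auxR α β n t - auxR α β (n + 1) t + 2) / t) t := by
  have hh := (sqNorm_pos hα hβ ht.le n).ne'
  have key : ∀ m, HasDerivAt (sqNorm α β m)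
      (-((auxR α β m t - (2 * m + 1 + α + β)) * sqNorm α β m t / t)) t := by
    intro m
    refine (hasDerivAt_sqNorm hα hβ ht m).congr_deriv ?_
    have h1 := sum_rule_X_mul_sq hα hβ ht m
    rw [moment_pred_right_sq hα hβ ht, ← auxR_mul_sqNorm hα hβ ht] at h1
    have ht0 := ht.ne'
    field_simp
    linarith
  refine ((key (n + 1)).div (key n) hh).congr_deriv ?_
  push_cast
  field_simp
  ring

/-- The relation for h_{n+1}/h_n is linear in r with coefficient N - 1 ≠ 0, so it is solved for r
and differentiated. The factor R in the conclusion allows R_n, which enters via (h_{n+1}/h_n)', to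
be removed through R (h_{n+1}/h_n) R_n = r² + β r. -/
theorem hasDerivAt_auxr (n : ℕ) {N : ℝ} (hN : N = 2 * ((n : ℝ) + 1) + 1 + α + β) :
    ∃ r', HasDerivAt (auxr α β n) (r' / t) t ∧
      (N - 1) * (auxR α β (n + 1) t * r') =
        N * (N - 2) * (auxr α β n t ^ 2 + β * auxr α β n t) -
        auxR α β (n + 1) t * (auxR α β (n + 1) t - 2) * ((orthoPoly α β t (n + 1)).coeff n ^ 2 +
          (N - 1 - β) * (orthoPoly α β t (n + 1)).coeff n + (N - 1) * auxr α β n t -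
          t * (orthoPoly α β t (n + 1)).coeff n - t * ((n : ℝ) + 1)) -
        auxR α β (n + 1) t * ((2 * (orthoPoly α β t (n + 1)).coeff n + N - 1 - β - t) *
          (auxr α β n t + (orthoPoly α β t (n + 1)).coeff n) -
          t * (orthoPoly α β t (n + 1)).coeff n - t * ((n : ℝ) + 1)) := by
  have hN1 : N - 1 ≠ 0 := by
    have : 0 < N - 1 := by rw [hN]; have := n.cast_nonneg (α := ℝ); linarith
    exact this.ne'
  have e : auxr α β n =ᶠ[𝓝 t] fun s =>
      (N * (N - 2) * (sqNorm α β (n + 1) s / sqNorm α β n s) -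
        (orthoPoly α β s (n + 1)).coeff n ^ 2 -
        (N - 1 - β) * (orthoPoly α β s (n + 1)).coeff n +
        s * (orthoPoly α β s (n + 1)).coeff n + s * ((n : ℝ) + 1)) / (N - 1) := by
    filter_upwards [lt_mem_nhds ht] with s hs
    rw [eq_div_iff hN1, (auxR_relations hα hβ hs n hN).2.1]
    ring
  have dρ := hasDerivAt_coeff hα hβ ht n
  have d := ((((((hasDerivAt_sqNorm_ratio hα hβ ht n).const_mul (N * (N - 2))).sub
    (dρ.pow 2)).sub (dρ.const_mul (N - 1 - β))).add ((hasDerivAt_id t).mul dρ)).add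
    ((hasDerivAt_id t).mul_const ((n : ℝ) + 1))).div_const (N - 1)
  have d' := d.congr_of_eventuallyEq e
  refine ⟨t * _, d'.congr_deriv (mul_div_cancel_left₀ _ ht.ne').symm, ?_⟩
  obtain ⟨r1, r2, -⟩ := auxR_relations hα hβ ht n hN
  -- Reinstating R_n and h_{n+1}/h_n turns the claim into a rational identity.
  rw [← r2, ← r1]
  have ht0 := ht.ne'
  simp only [id]
  field_simp
  ring

end Succ

end PollaczekJacobi

end

/-! ### The theorem. -/

open PollaczekJacobi in
theorem mainTheorem3 (α β : ℝ) (hα : 0 < α) (hβ : 0 < β) (n : ℕ) :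
    PollaczekJacobi.SolvesPainleveV
      ((2 * (n : ℝ) + 1 + α + β) ^ 2 / 2) (-β ^ 2 / 2) α (-1 / 2)
      (PollaczekJacobi.auxS α β n) := by
  have hn := n.cast_nonneg (α := ℝ)
  have hN1 : 1 < 2 * (n : ℝ) + 1 + α + β := by linarith
  cases n with
  | zero =>
    -- P_0 = 1 has no t-derivative, so R_0 satisfies the Riccati equation t R' = (R-β)(R-N) - t R,
    -- which is the system with r = ρ = 0. With ν = 0 the constraint is trivial.
    refine painleveV_of_system (r := fun _ => 0) (ρ := fun _ => 0) rfl hN1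
      (fun t ht => lt_auxR hα hβ ht 0) (fun t ht => ?_) (fun t _ => ?_)
      (fun t _ => ⟨0, ?_, ?_⟩) (fun t _ => ?_)
    · refine (hasDerivAt_auxR hα hβ ht 0).congr_deriv ?_
      have h : orthoPolyDeriv α β t 0 = 0 := by
        ext k
        exact (degree_lt_iff_coeff_zero _ 0).1 (degree_orthoPolyDeriv_lt hα hβ ht 0) k k.zero_le
      rw [h, eval_zero]
      ring
    · simpa using hasDerivAt_const t (0 : ℝ)
    · simpa using hasDerivAt_const t (0 : ℝ)
    · simp
    · simp
  | succ n =>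
    push_cast at hN1 ⊢
    have e : auxS α β (n + 1) =
        fun t => auxR α β (n + 1) t / (2 * ((n : ℝ) + 1) + 1 + α + β) := by
      funext t
      simp only [auxS]
      push_cast
      rfl
    rw [e]
    refine painleveV_of_system (r := auxr α β n)
      (ρ := fun s => (orthoPoly α β s (n + 1)).coeff n) rfl hN1 (fun t ht => ?_)
      (fun t ht => hasDerivAt_auxR_succ hα hβ ht n rfl) (fun t ht => hasDerivAt_coeff hα hβ ht n)
      (fun t ht => hasDerivAt_auxr hα hβ ht n rfl)
      (fun t ht => (auxR_relations hα hβ ht n rfl).2.2)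
    simpa using lt_auxR hα hβ ht (n + 1)
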